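/- **Setting.** Let $(\mathcal P^0,\Delta_0)=(\mathbb R^3,T\mathbb R^3)$, and let $(\mathcal P^{k+1},\Delta_{k+1})$ be the Cartan prolongation of $(\mathcal P^k,\Delta_k)$: the points of $\mathcal P^{k+1}$ are the pairs $(p,\ell)$ with $p\in\mathcal P^k$ and $\ell\subset\Delta_k(p)$ a line, and $\Delta_{k+1}(p,\ell)=(d\pi)^{-1}(\ell)$ for $\pi(p,\ell)=p$. For $p_k\in\mathcal P^k$ and $1\le i\le k$ let $p_i$ be its projection to $\mathcal P^i$ and $F_i(p_i)$ the fiber of $\mathcal P^i\to\mathcal P^{i-1}$ through $p_i$. Prolonging $(F_i(p_i),TF_i(p_i))$ $j$ times gives a submanifold $\mathcal P^j(F_i(p_i))\subset\mathcal P^{i+j}$. If $i+j=k$ and $p_k\in\mathcal P^j(F_i(p_i))$, we say that the Baby Monster born at level $i$ passes through $p_k$, and $\delta^j_i(p_k)=\Delta_k(p_k)\cap T_{p_k}\mathcal P^j(F_i(p_i))$ is called a critical plane at $p_k$. The vertical plane is $V=\delta^0_k(p_k)$. *Coordinates.* Near $p_k$, $\Delta_k$ is coframed by $(df_k,du_k,dv_k)$,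 where $(f_0,u_0,v_0)=(x,y,z)$ and, for $p_{k+1}=(p_k,\ell)$, the triple $(f_{k+1},u_{k+1},v_{k+1})$ is $(f_k,\frac{du_k}{df_k},\frac{dv_k}{df_k})$ if $df_k|_\ell\ne0$; $(u_k,\frac{df_k}{du_k},\frac{dv_k}{du_k})$ if $df_k|_\ell=0\neq du_k|_\ell$; and $(v_k,\frac{df_k}{dv_k},\frac{du_k}{dv_k})$ otherwise. The plane $\{du_k=0\}\subset\Delta_k(p_k)$ is called $T_1$ when it is a critical plane, and $\{dv_k=0\}\subset\Delta_k(p_k)$ is called $T_2$ when it is a critical plane; otherwise $T_1$, respectively $T_2$, is absent at $p_k$. *Codes.* A line $\ell\subset\Delta_k(p_k)$ is critical if it is tangent to an immersed integral curve of $\Delta_k$ through $p_k$ with constant projection to $\mathbb R^3$ (for $k=0$ there is none), and regular otherwise. The letter of $(p_k,\ell)$ is $R$ if $\ell$ is regular. If $\ell$ is critical, it is $L_1$, $L_2$, $L_3$ if $\ell$ lies in $V\cap T_1$, $T_1\cap T_2$, $V\cap T_2$ respectively, and otherwise it is $V$, $T_1$ or $T_2$ according to which of these planes contains $\ell$. The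 RVT code of $p_k$ is the word of the letters of $p_1,\dots,p_k$. We write $L=L_1$, $T=T_1$. **Theorem.** Let $\omega$ be an RVT code of length $k$ whose last letter is $L_2$, $L_3$ or $T_2$, and is the first occurrence of that letter in $\omega$. Then the critical planes in $\Delta_k(p_k)$, together with the levels at which they are born, are the same for all $p_k$ with code $\omega$: 1. If the last letter is $L_2$ or $L_3$, the critical planes at $p_k$ are exactly $V$, $T_1$ and $T_2$, all three present, each coming from exactly one Baby Monster. They are $2$-dimensional, meet pairwise in lines, and $V\cap T_1\cap T_2=0$. Moreover $T_1=\delta^2_{k-2}(p_k)$ if the last letter is $L_2$, and $T_1=\delta^1_{k-1}(p_k)$ if it is $L_3$; and $T_2=\delta^{k-i}_i(p_k)$ with $i$ depending only on $\omega$. 2. If the last letter is $T_2$, the critical planes at $p_k$ are exactly $V$ and $T_2$, each coming from exactly one Baby Monster; there is no $T_1$. They are $2$-dimensional and meet in a line, and $T_2=\delta^{k-i}_i(p_k)$ with $i$ depending only on $\omega$. 3. For the following codes the planes are as listed (at $p_k$, with $k$ the length of the code; $\omega'$ is any block of letters, $r$ is its length, $m\ge0$, $s\ge2$): | code | $T_1$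 | $T_2$ | |---|---|---| | $R\omega'VT^mLL_2$ | $\delta^2_{m+r+2}$ | $\delta^{m+3}_{r+1}$ | | $R\omega'LLL_2$ | $\delta^2_{k-2}$ | $\delta^3_{k-3}$ | | $R\omega'VT^mLL_3$ | $\delta^1_{k-1}$ | $\delta^{m+3}_{r+1}$ | | $R\omega'LLL_3$ | $\delta^1_{k-1}$ | $\delta^3_{k-3}$ | | $R\omega'VT^mLT_2L_3$ | $\delta^1_{k-1}$ | $\delta^{m+4}_{r+1}$ | | $R\omega'LLT_2L_3$ | $\delta^1_{k-1}$ | $\delta^4_{k-4}$ | | $R\omega'VT^mLL_2T_2L_3$ | $\delta^1_{k-1}$ | $\delta^{m+5}_{r+1}$ | | $R\omega'VT^mL^sL_2T_2L_3$ | $\delta^1_{k-1}$ | $\delta^5_{m+s+r}$ | | $R\omega'VT^mLT_2$ | none | $\delta^{m+3}_{r+1}$ | | $R\omega'LLT_2$ | none | $\delta^3_{k-3}$ | | $R\omega'VT^mLL_2T_2$ | none | $\delta^{m+4}_{r+1}$ | | $R\omega'VT^mL^sL_2T_2$ | none | $\delta^4_{m+s+r}$ | | $R\omega'VT^mLL_3T_2$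 | none | $\delta^{m+4}_{r+1}$ | | $R\omega'VT^mL^sL_3T_2$ | none | $\delta^4_{m+s+r}$ | -/

import Mathlib

open scoped Topology

namespace Monster

/-! ## Distributions, tangent spaces and Cartan prolongation

Every manifold below is realised as a submanifold of a coordinate space `ι → ℝ` with `ι` finite.
A line `ℓ ⊂ ι → ℝ` is recorded by the matrix of the orthogonal projection onto it; this embeds the
projective space of lines as a submanifold of the space of matrices. -/

/-- The tangent space at `q` of a submanifold `S` of `ι → ℝ`: the velocities at `q` of the smooth
curves that run in `S`. -/
def tangentSpace {ι : Type} [Fintype ι] (S : Set (ι → ℝ)) (q : ι → ℝ) : Submodule ℝ (ι → ℝ) :=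
  Submodule.span ℝ {w | ∃ γ : ℝ → ι → ℝ, ContDiffAt ℝ (⊤ : ℕ∞) γ 0 ∧ γ 0 = q ∧
    (∀ᶠ t in 𝓝 (0 : ℝ), γ t ∈ S) ∧ deriv γ 0 = w}

/-- A pair `(Z, Δ)`: a submanifold `Z` of `ι → ℝ` and a field `Δ` of linear subspaces, of which only
the values at the points of `Z` matter. -/
structure Distribution (ι : Type) where
  carrier : Set (ι → ℝ)
  plane : (ι → ℝ) → Submodule ℝ (ι → ℝ)

/-- The projection `(p, ℓ) ↦ p`, as a linear map of the ambient spaces. -/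
def base {ι : Type} : (ι ⊕ ι × ι → ℝ) →ₗ[ℝ] (ι → ℝ) := LinearMap.funLeft ℝ ℝ Sum.inl

/-- The matrix component of `(p, ℓ)`: the orthogonal projection onto `ℓ`. -/
def dirMatrix {ι : Type} (q : ι ⊕ ι × ι → ℝ) : Matrix ι ι ℝ :=
  Matrix.of fun i j => q (Sum.inr (i, j))

/-- The line `ℓ` of the point `(p, ℓ)`. -/
def line {ι : Type} [Fintype ι] (q : ι ⊕ ι × ι → ℝ) : Submodule ℝ (ι → ℝ) :=
  LinearMap.range (dirMatrix q).mulVecLin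

/-- The Cartan prolongation `(ℙΔ, Δ₁)` of `(Z, Δ)`: the points are the pairs `(p, ℓ)` of a point `p`
of `Z` and a line `ℓ ⊂ Δ(p)` (spanned by a unit vector `w`, so that the orthogonal projection is
`w wᵀ`), and `Δ₁(p, ℓ) = (dπ)⁻¹(ℓ)` inside the tangent space of `ℙΔ` at `(p, ℓ)`. -/
def Distribution.prolong {ι : Type} [Fintype ι] (D : Distribution ι) :
    Distribution (ι ⊕ ι × ι) :=
  let Z₁ : Set (ι ⊕ ι × ι → ℝ) := {q | base q ∈ D.carrier ∧
    ∃ w ∈ D.plane (base q), ∑ i, w i ^ 2 = 1 ∧ dirMatrix q = Matrix.vecMulVec w w}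
  { carrier := Z₁
    plane := fun q => tangentSpace Z₁ q ⊓ (line q).comap base }

/-! ## The Monster Tower over `ℝ³` -/

/-- The coordinates of the space in which level `k` of the tower is embedded. -/
def Idx : ℕ → Type
  | 0 => Fin 3
  | k + 1 => Idx k ⊕ Idx k × Idx k

instance instFintypeIdx : (k : ℕ) → Fintype (Idx k)
  | 0 => inferInstanceAs (Fintype (Fin 3))
  | k + 1 =>
    letI := instFintypeIdx k
    inferInstanceAs (Fintype (Idx k ⊕ Idx k × Idx k))

/-- The ambient space of level `k`. -/
abbrev Vec (k : ℕ) : Type := Idx k → ℝ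

/-- The `k`-th level `(𝒫ᵏ, Δ_k)` of the Monster Tower of `ℝ³`. -/
def tower : (k : ℕ) → Distribution (Idx k)
  | 0 => { carrier := Set.univ, plane := fun _ => ⊤ }
  | k + 1 => (tower k).prolong

/-- The projection from level `k + 1` to level `k`. -/
def down {k : ℕ} (q : Vec (k + 1)) : Vec k := base (ι := Idx k) q

/-- The line `ℓ ⊂ Δ_k(p)` of a point `(p, ℓ)` of level `k + 1`. -/
def dir {k : ℕ} (q : Vec (k + 1)) : Submodule ℝ (Vec k) := line (ι := Idx k) q

/-- The projection from level `k` to the base `ℝ³`. -/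
def toBase : (k : ℕ) → Vec k → Vec 0
  | 0, p => p
  | k + 1, p => toBase k (down p)

/-! ## Baby Monsters and critical planes -/

/-- The fiber of `𝒫ᵏ⁺¹ → 𝒫ᵏ` through the point `p` of level `k + 1`. -/
def fiber {k : ℕ} (p : Vec (k + 1)) : Set (Vec (k + 1)) :=
  {q | q ∈ (tower (k + 1)).carrier ∧ down q = down p}

/-- For a point `p` of level `k` and `1 ≤ i ≤ k`, with `p_i` the projection of `p` to level `i`:
the pair `(𝒫ʲ(F), Δ^F_j)`, `j = k - i`, obtained by prolonging `j` times the pair `(F, TF)`, where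
`F = F_i(p_i)` is the fiber of `𝒫ⁱ → 𝒫ⁱ⁻¹` through `p_i`. (Empty if `i = 0` or `i > k`.) -/
def baby : (k : ℕ) → (i : ℕ) → Vec k → Distribution (Idx k)
  | 0, _, _ => { carrier := ∅, plane := fun _ => ⊥ }
  | k + 1, i, p =>
    if i = k + 1 then { carrier := fiber p, plane := tangentSpace (fiber p) }
    else (baby k i (down p)).prolong

/-- The Baby Monster born at level `i` passes through the point `p` of level `k`. -/
def Passes {k : ℕ} (i : ℕ) (p : Vec k) : Prop := p ∈ (baby k i p).carrier

/-- The plane `δ^j_i(p) = Δ_k(p) ∩ T_p(𝒫ʲ(F_i(p_i)))`, where `k` is the level of `p` and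
`j = k - i`. It is a critical plane if the Baby Monster born at level `i` passes through `p`. -/
def delta {k : ℕ} (i : ℕ) (p : Vec k) : Submodule ℝ (Vec k) :=
  (tower k).plane p ⊓ tangentSpace (baby k i p).carrier p

/-- The vertical plane `δ^0_k(p)`. -/
def vertical {k : ℕ} (p : Vec k) : Submodule ℝ (Vec k) := delta k p

/-- A direction `ℓ ⊂ Δ_k(p)` is critical if it is tangent to an immersed integral curve of `Δ_k`
through `p` whose projection to the base `ℝ³` is constant. -/
def IsCriticalDir {k : ℕ} (p : Vec k) (ℓ : Submodule ℝ (Vec k)) : Prop :=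
  ∃ γ : ℝ → Vec k, ContDiffAt ℝ (⊤ : ℕ∞) γ 0 ∧ γ 0 = p ∧
    (∀ᶠ t in 𝓝 (0 : ℝ), γ t ∈ (tower k).carrier ∧ deriv γ t ∈ (tower k).plane (γ t) ∧
      toBase k (γ t) = toBase k p) ∧
    deriv γ 0 ≠ 0 ∧ deriv γ 0 ∈ ℓ

/-! ## Kumpera-Rubin coordinates -/

/-- Three functions whose differentials coframe the distribution: the uniformizing coordinate `f`
and the two fiber coordinates `u` and `v`. -/
structure KR (ι : Type) where
  f : (ι → ℝ) → ℝ
  u : (ι → ℝ) → ℝ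
  v : (ι → ℝ) → ℝ

open Classical in
/-- The gradient of `f` at `p`. -/
noncomputable def grad {ι : Type} [Fintype ι] (f : (ι → ℝ) → ℝ) (p : ι → ℝ) : ι → ℝ :=
  fun i => fderiv ℝ f p (Pi.single i 1)

/-- The function `(p, ℓ) ↦ (dg / df)|_ℓ`, defined where `df` does not vanish on `ℓ`. The vector
at which `dg` and `df` are evaluated is the orthogonal projection to `ℓ` of the gradient of `f`;
it spans `ℓ` when `df` does not vanish on `ℓ`. -/
noncomputable def slope {ι : Type} [Fintype ι] (g f : (ι → ℝ) → ℝ) (q : ι ⊕ ι × ι → ℝ) : ℝ :=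
  fderiv ℝ g (base q) ((dirMatrix q).mulVec (grad f (base q))) /
    fderiv ℝ f (base q) ((dirMatrix q).mulVec (grad f (base q)))

/-- The differential of `g` at `p` does not vanish on the line `ℓ ∋ x`. -/
def NonzeroOn {ι : Type} [Fintype ι] (g : (ι → ℝ) → ℝ) (p : ι → ℝ) (ℓ : Submodule ℝ (ι → ℝ)) :
    Prop :=
  ∃ x ∈ ℓ, fderiv ℝ g p x ≠ 0

open Classical in
/-- From the coordinates `(f, u, v)` near `p` to those near `q = (p, ℓ)`: one passes to affine
coordinates of `[df : du : dv]`, dividing by the first of `df`, `du`, `dv` that does not vanish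
on `ℓ`; that coordinate becomes the uniformizing one, and the two quotients, in their order, are the
new fiber coordinates. -/
noncomputable def KR.next {ι : Type} [Fintype ι] (c : KR ι) (q : ι ⊕ ι × ι → ℝ) :
    KR (ι ⊕ ι × ι) :=
  if NonzeroOn c.f (base q) (line q) then
    { f := fun x => c.f (base x), u := slope c.u c.f, v := slope c.v c.f }
  else if NonzeroOn c.u (base q) (line q) then
    { f := fun x => c.u (base x), u := slope c.f c.u, v := slope c.v c.u }
  else
    { f := fun x => c.v (base x), u := slope c.f c.v, v := slope c.u c.v }

/-- The coordinates `(f_k, u_k, v_k)` near the point `p` of level `k`, starting from the coordinates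
`(x, y, z)` of `ℝ³`. -/
noncomputable def kr : (k : ℕ) → Vec k → KR (Idx k)
  | 0, _ =>
    { f := fun x : Fin 3 → ℝ => x 0, u := fun x : Fin 3 → ℝ => x 1, v := fun x : Fin 3 → ℝ => x 2 }
  | k + 1, q => KR.next (ι := Idx k) (kr k (down q)) q

/-- The plane `[df_k : du_k : dv_k] = [a : 0 : b]` in `Δ_k(p)`; when it is a critical plane, it is
the critical plane `T₁` at `p`. -/
noncomputable def planeT1 {k : ℕ} (p : Vec k) : Submodule ℝ (Vec k) :=
  (tower k).plane p ⊓ LinearMap.ker (fderiv ℝ (kr k p).u p : Vec k →ₗ[ℝ] ℝ)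

/-- The plane `[df_k : du_k : dv_k] = [a : b : 0]` in `Δ_k(p)`; when it is a critical plane, it is
the critical plane `T₂` at `p`. -/
noncomputable def planeT2 {k : ℕ} (p : Vec k) : Submodule ℝ (Vec k) :=
  (tower k).plane p ⊓ LinearMap.ker (fderiv ℝ (kr k p).v p : Vec k →ₗ[ℝ] ℝ)

/-- `W` is one of the critical planes at `p`. -/
def IsCriticalPlane {k : ℕ} (p : Vec k) (W : Submodule ℝ (Vec k)) : Prop :=
  ∃ i, Passes i p ∧ delta i p = W

/-! ## RVT codes -/

inductive Letter
  | R | V | T1 | T2 | L1 | L2 | L3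

/-- The line `ℓ` lies in the critical plane `T₁` at `p` (which is present). -/
def InT1 {k : ℕ} (p : Vec k) (ℓ : Submodule ℝ (Vec k)) : Prop :=
  IsCriticalPlane p (planeT1 p) ∧ ℓ ≤ planeT1 p

/-- The line `ℓ` lies in the critical plane `T₂` at `p` (which is present). -/
def InT2 {k : ℕ} (p : Vec k) (ℓ : Submodule ℝ (Vec k)) : Prop :=
  IsCriticalPlane p (planeT2 p) ∧ ℓ ≤ planeT2 p

/-- The letter of the point `(p, ℓ)`: `R` for a regular direction; for a critical one, `L₁`, `L₂`,
`L₃` for the distinguished lines `V ∩ T₁`, `T₁ ∩ T₂`, `V ∩ T₂`, and otherwise the name of the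
critical plane that contains `ℓ`. -/
def HasLetter {k : ℕ} (p : Vec k) (ℓ : Submodule ℝ (Vec k)) : Letter → Prop
  | .R => ¬ IsCriticalDir p ℓ
  | .V => IsCriticalDir p ℓ ∧ ℓ ≤ vertical p ∧ ¬ InT1 p ℓ ∧ ¬ InT2 p ℓ
  | .T1 => IsCriticalDir p ℓ ∧ InT1 p ℓ ∧ ¬ ℓ ≤ vertical p ∧ ¬ InT2 p ℓ
  | .T2 => IsCriticalDir p ℓ ∧ InT2 p ℓ ∧ ¬ ℓ ≤ vertical p ∧ ¬ InT1 p ℓ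
  | .L1 => IsCriticalDir p ℓ ∧ ℓ ≤ vertical p ∧ InT1 p ℓ
  | .L2 => IsCriticalDir p ℓ ∧ InT1 p ℓ ∧ InT2 p ℓ
  | .L3 => IsCriticalDir p ℓ ∧ ℓ ≤ vertical p ∧ InT2 p ℓ

/-- The point `p` of level `k` has the RVT code `ω`. -/
def HasCode : (k : ℕ) → Vec k → List Letter → Prop
  | 0, _, ω => ω = []
  | k + 1, q, ω => ∃ (ω₀ : List Letter) (X : Letter), ω = ω₀ ++ [X] ∧
      HasCode k (down q) ω₀ ∧ HasLetter (down q) (dir q) X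

/-- The last letter of `ω` is `X`, it is one of `L₂`, `L₃`, `T₂`, and this is the first occurrence
of `X` in `ω`. -/
def FirstOccurrence (ω : List Letter) (X : Letter) : Prop :=
  (X = .L2 ∨ X = .L3 ∨ X = .T2) ∧ ∃ ω₀ : List Letter, ω = ω₀ ++ [X] ∧ X ∉ ω₀

/-! ## Configurations of critical planes -/

/-- The plane `W` of `Δ_k(p)` is the critical plane `δ^j_i(p)` if the entry is `(j, i)`, and is not
a critical plane if the entry is `none`. -/
def IsSource {k : ℕ} (p : Vec k) (W : Submodule ℝ (Vec k)) : Option (ℕ × ℕ) → Prop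
  | some (j, i) => i + j = k ∧ Passes i p ∧ delta i p = W
  | none => ¬ IsCriticalPlane p W

/-- The sources of `T₁` and `T₂` at `p` are `e₁` and `e₂`, and the only Baby Monsters through `p`
are these and the one which gives the vertical plane. -/
def Sources {k : ℕ} (p : Vec k) (e₁ e₂ : Option (ℕ × ℕ)) : Prop :=
  IsSource p (planeT1 p) e₁ ∧ IsSource p (planeT2 p) e₂ ∧
    ∀ i, Passes i p ↔ i = k ∨ (∃ j, e₁ = some (j, i)) ∨ (∃ j, e₂ = some (j, i))

/-- `V`, `T₁`, `T₂` are planes in general position in `Δ_k(p)`: they meet pairwise in lines and have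
only `0` in common (so `L₁ = V ∩ T₁`, `L₂ = T₁ ∩ T₂`, `L₃ = V ∩ T₂` are three distinct lines). -/
def ThreePlanes {k : ℕ} (p : Vec k) : Prop :=
  Module.finrank ℝ (vertical p) = 2 ∧ Module.finrank ℝ (planeT1 p) = 2 ∧
    Module.finrank ℝ (planeT2 p) = 2 ∧
    Module.finrank ℝ (vertical p ⊓ planeT1 p : Submodule ℝ (Vec k)) = 1 ∧
    Module.finrank ℝ (planeT1 p ⊓ planeT2 p : Submodule ℝ (Vec k)) = 1 ∧
    Module.finrank ℝ (vertical p ⊓ planeT2 p : Submodule ℝ (Vec k)) = 1 ∧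
    vertical p ⊓ planeT1 p ⊓ planeT2 p = ⊥

/-- `V` and `T₂` are planes that meet in a line (the line `L₃`). -/
def TwoPlanes {k : ℕ} (p : Vec k) : Prop :=
  Module.finrank ℝ (vertical p) = 2 ∧ Module.finrank ℝ (planeT2 p) = 2 ∧
    Module.finrank ℝ (vertical p ⊓ planeT2 p : Submodule ℝ (Vec k)) = 1

open Letter in
/-- The table of sources: `TableRow ω e₁ e₂` says that for the code `ω` the table lists `e₁` as the
source of `T₁` and `e₂` as the source of `T₂`, where `some (j, i)` stands for `δ^j_i` and `none` for
the absence of the plane. In each row `w` is an arbitrary block of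
letters and `k` is the total length of the code. -/
inductive TableRow : List Letter → Option (ℕ × ℕ) → Option (ℕ × ℕ) → Prop
  | VTLL2 (w : List Letter) (m : ℕ) :
      TableRow ([R] ++ w ++ [V] ++ List.replicate m T1 ++ [L1, L2])
        (some (2, m + 2 + w.length)) (some (m + 3, 1 + w.length))
  | LLL2 (w : List Letter) (k : ℕ) (hk : k = w.length + 4) :
      TableRow ([R] ++ w ++ [L1, L1, L2]) (some (2, k - 2)) (some (3, k - 3))
  | VTLL3 (w : List Letter) (m k : ℕ) (hk : k = m + w.length + 4) :
      TableRow ([R] ++ w ++ [V] ++ List.replicate m T1 ++ [L1, L3])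
        (some (1, k - 1)) (some (m + 3, w.length + 1))
  | LLL3 (w : List Letter) (k : ℕ) (hk : k = w.length + 4) :
      TableRow ([R] ++ w ++ [L1, L1, L3]) (some (1, k - 1)) (some (3, k - 3))
  | VTLT2L3 (w : List Letter) (m k : ℕ) (hk : k = m + w.length + 5) :
      TableRow ([R] ++ w ++ [V] ++ List.replicate m T1 ++ [L1, T2, L3])
        (some (1, k - 1)) (some (m + 4, w.length + 1))
  | LLT2L3 (w : List Letter) (k : ℕ) (hk : k = w.length + 5) :
      TableRow ([R] ++ w ++ [L1, L1, T2, L3]) (some (1, k - 1)) (some (4, k - 4))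
  | VTLL2T2L3 (w : List Letter) (m k : ℕ) (hk : k = m + w.length + 6) :
      TableRow ([R] ++ w ++ [V] ++ List.replicate m T1 ++ [L1, L2, T2, L3])
        (some (1, k - 1)) (some (m + 5, w.length + 1))
  | VTLsL2T2L3 (w : List Letter) (m s k : ℕ) (hs : 2 ≤ s) (hk : k = m + s + w.length + 5) :
      TableRow ([R] ++ w ++ [V] ++ List.replicate m T1 ++ List.replicate s L1 ++ [L2, T2, L3])
        (some (1, k - 1)) (some (5, m + s + w.length))
  | VTLT2 (w : List Letter) (m : ℕ) :
      TableRow ([R] ++ w ++ [V] ++ List.replicate m T1 ++ [L1, T2])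
        none (some (m + 3, 1 + w.length))
  | LLT2 (w : List Letter) (k : ℕ) (hk : k = w.length + 4) :
      TableRow ([R] ++ w ++ [L1, L1, T2]) none (some (3, k - 3))
  | VTLL2T2 (w : List Letter) (m : ℕ) :
      TableRow ([R] ++ w ++ [V] ++ List.replicate m T1 ++ [L1, L2, T2])
        none (some (m + 4, w.length + 1))
  | VTLsL2T2 (w : List Letter) (m s : ℕ) (hs : 2 ≤ s) :
      TableRow ([R] ++ w ++ [V] ++ List.replicate m T1 ++ List.replicate s L1 ++ [L2, T2])
        none (some (4, w.length + m + s))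
  | VTLL3T2 (w : List Letter) (m : ℕ) :
      TableRow ([R] ++ w ++ [V] ++ List.replicate m T1 ++ [L1, L3, T2])
        none (some (m + 4, w.length + 1))
  | VTLsL3T2 (w : List Letter) (m s : ℕ) (hs : 2 ≤ s) :
      TableRow ([R] ++ w ++ [V] ++ List.replicate m T1 ++ List.replicate s L1 ++ [L3, T2])
        none (some (4, m + s + w.length))

end Monster

/-! Near every point `(df, du, dv)` are linear coordinates on the planes of the tower, and each Baby
Monster through the point keeps exactly one of `f`, `u`, `v` constant. Hence its critical plane is
one of `df = 0`, `du = 0`, `dv = 0`, that is `V`, `T₁` or `T₂`. The newborn one is a fiber: it keeps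
`f` constant and gives `V`. Let the next line be spanned by `w` with components `x`. A Baby Monster
that keeps coordinate `j` constant survives iff `x j = 0` (`LineSpan.passes_iff`). Its new constant
coordinate is the slope of the old one, whose index is permuted by the division (`LineSpan.babyAt`).
So `V` turns into `T₁`; `T₁` turns into `T₂` if `V` also contains the line and otherwise stays; `T₂`
stays. Since `x ≠ 0`, at most two planes contain the line. The birth levels of `T₁` and `T₂` thus
evolve by a rule in the level and the letter alone, `nextSources` (`BabyState.succ`), and the
theorem is read off by running this rule along the code. The analytic input is `Framed`: a
coordinate frame together with enough integral curves. It holds on `ℝ³` (`framed_top`) and on fibers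
(`Framed.fiber`), and prolongation preserves it (`Framed.prolong`). The integral curves show that
the coordinate planes really consist of velocities, so that no inverse function theorem is needed.
-/

namespace Monster

/-! ### Tangent spaces defined by curves -/

section TangentSpace

variable {ι : Type} [Fintype ι]

theorem tangentSpace_mono {S T : Set (ι → ℝ)} (h : S ⊆ T) (q : ι → ℝ) :
    tangentSpace S q ≤ tangentSpace T q := by
  refine Submodule.span_mono ?_
  rintro w ⟨γ, h1, h2, h3, h4⟩
  exact ⟨γ, h1, h2, h3.mono fun t ht => h ht, h4⟩

theorem deriv_mem_tangentSpace {S : Set (ι → ℝ)} {γ : ℝ → ι → ℝ} {t : ℝ}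
    (hγ : ContDiffAt ℝ (⊤ : ℕ∞) γ t) (hS : ∀ᶠ s in 𝓝 t, γ s ∈ S) :
    deriv γ t ∈ tangentSpace S (γ t) := by
  refine Submodule.subset_span ⟨fun s => γ (s + t), ?_, by simp, ?_, ?_⟩
  · have : ContDiffAt ℝ (⊤ : ℕ∞) γ (0 + t) := by simpa using hγ
    exact this.comp (0 : ℝ) (contDiffAt_id.add contDiffAt_const)
  · have : Filter.Tendsto (fun s : ℝ => s + t) (𝓝 0) (𝓝 t) := by
      have h : Continuous fun s : ℝ => s + t := by fun_prop
      simpa using h.tendsto 0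
    exact this.eventually hS
  · simpa using deriv_comp_add_const γ t 0

/-- Functions that agree on `S` have the same differential on the tangent space of `S`. -/
theorem fderiv_eq_on_tangentSpace {F : Type*} [NormedAddCommGroup F] [NormedSpace ℝ F]
    {S : Set (ι → ℝ)} {q : ι → ℝ} {g h : (ι → ℝ) → F} (hg : DifferentiableAt ℝ g q)
    (hh : DifferentiableAt ℝ h q) (hgh : ∀ᶠ x in 𝓝 q, x ∈ S → g x = h x) {w : ι → ℝ}
    (hw : w ∈ tangentSpace S q) : fderiv ℝ g q w = fderiv ℝ h q w := by
  induction hw using Submodule.span_induction with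
  | mem w hw =>
    obtain ⟨γ, h1, rfl, h3, rfl⟩ := hw
    have hd := (h1.differentiableAt (by simp)).hasDerivAt
    have e1 := (hg.hasFDerivAt.comp_hasDerivAt (0 : ℝ) hd).deriv
    have e2 := (hh.hasFDerivAt.comp_hasDerivAt (0 : ℝ) hd).deriv
    rw [← e1, ← e2]
    refine Filter.EventuallyEq.deriv_eq ?_
    filter_upwards [h3, h1.continuousAt.eventually hgh] with t h h'
    exact h' h
  | zero => simp
  | add x y _ _ hx hy => simp [hx, hy]
  | smul a x _ hx => simp [hx]

theorem contDiff_base {n : WithTop ℕ∞} : ContDiff ℝ n (base : (ι ⊕ ι × ι → ℝ) →ₗ[ℝ] (ι → ℝ)) :=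
  (LinearMap.toContinuousLinearMap (base (ι := ι))).contDiff

theorem hasFDerivAt_base (q : ι ⊕ ι × ι → ℝ) :
    HasFDerivAt (base : (ι ⊕ ι × ι → ℝ) →ₗ[ℝ] (ι → ℝ)) (LinearMap.toContinuousLinearMap base) q :=
  (LinearMap.toContinuousLinearMap (base (ι := ι))).hasFDerivAt

theorem fderiv_comp_base {g : (ι → ℝ) → ℝ} {q : ι ⊕ ι × ι → ℝ}
    (hg : DifferentiableAt ℝ g (base q)) (w : ι ⊕ ι × ι → ℝ) :
    fderiv ℝ (fun y => g (base y)) q w = fderiv ℝ g (base q) (base w) := by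
  have := (hg.hasFDerivAt.comp q (hasFDerivAt_base q)).fderiv
  exact congrArg (fun L => L w) this

theorem hasDerivAt_base {γ : ℝ → (ι ⊕ ι × ι → ℝ)} {t : ℝ} {w : ι ⊕ ι × ι → ℝ}
    (h : HasDerivAt γ w t) : HasDerivAt (fun s => base (γ s)) (base w) t :=
  (hasFDerivAt_base (γ t)).comp_hasDerivAt t h

theorem base_eq_zero_of_mem_tangentSpace {F : Set (ι ⊕ ι × ι → ℝ)} {p : ι → ℝ}
    (hF : ∀ q ∈ F, base q = p) {q w : ι ⊕ ι × ι → ℝ} (hw : w ∈ tangentSpace F q) :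
    base w = 0 := by
  have := fderiv_eq_on_tangentSpace (h := fun _ => p) (hasFDerivAt_base q).differentiableAt
    (differentiableAt_const _) (Filter.Eventually.of_forall hF) hw
  rw [(hasFDerivAt_base q).fderiv] at this
  simpa using this

/-- This removes the gradient from `slope`: projecting it to a line brings in only the differential
of `f` on that line. -/
theorem dotProduct_grad (f : (ι → ℝ) → ℝ) (p w : ι → ℝ) : w ⬝ᵥ grad f p = fderiv ℝ f p w := by
  classical
  conv_rhs => rw [show w = ∑ i, w i • (Pi.single i 1 : ι → ℝ) by
    ext j; simp [Finset.sum_apply, Pi.single_apply]]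
  rw [map_sum]
  simp only [dotProduct, grad, map_smul, smul_eq_mul]

end TangentSpace

/-! ### Points of the prolongation given by a spanning vector -/

section ProjPoint

variable {ι : Type} [Fintype ι]

/-- The point `(x, ℓ)` for the line `ℓ` spanned by `v`. -/
noncomputable def projPoint (x v : ι → ℝ) : ι ⊕ ι × ι → ℝ :=
  Sum.elim x fun ij => v ij.1 * v ij.2 / ∑ l, v l ^ 2

@[simp] theorem base_projPoint (x v : ι → ℝ) : base (projPoint x v) = x := by
  ext i; simp [base, projPoint, LinearMap.funLeft]

theorem sum_sq_pos {v : ι → ℝ} (hv : v ≠ 0) : 0 < ∑ l, v l ^ 2 := by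
  obtain ⟨i, hi⟩ := Function.ne_iff.1 hv
  exact Finset.sum_pos' (fun j _ => sq_nonneg _) ⟨i, Finset.mem_univ _, by
    have : v i ≠ 0 := hi
    positivity⟩

theorem dirMatrix_projPoint (x v : ι → ℝ) :
    dirMatrix (projPoint x v) = (∑ l, v l ^ 2)⁻¹ • Matrix.vecMulVec v v := by
  ext i j
  simp [dirMatrix, projPoint, Matrix.vecMulVec_apply]
  ring

theorem mulVec_projPoint (x v y : ι → ℝ) :
    (dirMatrix (projPoint x v)).mulVec y = ((∑ l, v l ^ 2)⁻¹ * (v ⬝ᵥ y)) • v := by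
  rw [dirMatrix_projPoint, Matrix.smul_mulVec, Matrix.vecMulVec_mulVec]
  ext i
  simp
  ring

theorem mem_line_projPoint {x v y : ι → ℝ} (hv : v ≠ 0) :
    y ∈ line (projPoint x v) ↔ ∃ c : ℝ, y = c • v := by
  have hs := (sum_sq_pos hv).ne'
  constructor
  · rintro ⟨z, rfl⟩
    exact ⟨_, by rw [Matrix.mulVecLin_apply, mulVec_projPoint]⟩
  · rintro ⟨c, rfl⟩
    refine ⟨c • v, ?_⟩
    rw [Matrix.mulVecLin_apply, mulVec_projPoint]
    have : v ⬝ᵥ v = ∑ l, v l ^ 2 := by simp [dotProduct, sq]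
    rw [dotProduct_smul, this, smul_eq_mul, mul_left_comm, inv_mul_cancel₀ hs, mul_one]

/-- The projected gradient is a multiple of `v`, and the factor cancels in the quotient. -/
theorem slope_projPoint {x v : ι → ℝ} (hv : v ≠ 0) {f : (ι → ℝ) → ℝ} (hf : fderiv ℝ f x v ≠ 0)
    (g : (ι → ℝ) → ℝ) : slope g f (projPoint x v) = fderiv ℝ g x v / fderiv ℝ f x v := by
  have hs := (sum_sq_pos hv).ne'
  simp only [slope, base_projPoint, mulVec_projPoint, dotProduct_grad, map_smul, smul_eq_mul]
  field_simp

/-- For `v ≠ 0` the denominator of a slope vanishes exactly when the differential of `f` does on the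
line. -/
theorem fderiv_mulVec_grad_projPoint (x v : ι → ℝ) (f : (ι → ℝ) → ℝ) :
    fderiv ℝ f x ((dirMatrix (projPoint x v)).mulVec (grad f x)) =
      (∑ l, v l ^ 2)⁻¹ * fderiv ℝ f x v ^ 2 := by
  simp only [mulVec_projPoint, dotProduct_grad, map_smul, smul_eq_mul]
  ring

theorem projPoint_smul (x v : ι → ℝ) {c : ℝ} (hc : c ≠ 0) :
    projPoint x (c • v) = projPoint x v := by
  ext (i | ij)
  · rfl
  · simp only [projPoint, Sum.elim_inr, Pi.smul_apply, smul_eq_mul, mul_pow, ← Finset.mul_sum]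
    rw [show c * v ij.1 * (c * v ij.2) = c ^ 2 * (v ij.1 * v ij.2) by ring,
      mul_div_mul_left _ _ (pow_ne_zero 2 hc)]

/-- `projPoint` divides by the squared norm, so any spanning vector can replace the unit vector of
the definition. -/
theorem mem_prolong_carrier {D : Distribution ι} {q : ι ⊕ ι × ι → ℝ} :
    q ∈ D.prolong.carrier ↔
      base q ∈ D.carrier ∧ ∃ w ∈ D.plane (base q), w ≠ 0 ∧ q = projPoint (base q) w := by
  refine and_congr_right fun _ => ⟨?_, ?_⟩
  · rintro ⟨w, hw, h1, h2⟩
    refine ⟨w, hw, ?_, ?_⟩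
    · rintro rfl
      simp at h1
    · ext (i | ⟨i, j⟩)
      · rfl
      · have := congrFun (congrFun h2 i) j
        simpa [projPoint, h1, dirMatrix, Matrix.vecMulVec_apply] using this
  · rintro ⟨w, hw, h0, h⟩
    have hs := sum_sq_pos h0
    refine ⟨(√(∑ l, w l ^ 2))⁻¹ • w, Submodule.smul_mem _ _ hw, ?_, ?_⟩
    · simp only [Pi.smul_apply, smul_eq_mul, mul_pow, ← Finset.mul_sum, inv_pow,
        Real.sq_sqrt hs.le]
      exact inv_mul_cancel₀ hs.ne'
    · rw [h, dirMatrix_projPoint]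
      ext i j
      simp only [Matrix.smul_apply, Matrix.vecMulVec_apply, Pi.smul_apply, smul_eq_mul]
      rw [show (√(∑ l, w l ^ 2))⁻¹ * w i * ((√(∑ l, w l ^ 2))⁻¹ * w j) =
        ((√(∑ l, w l ^ 2)) ^ 2)⁻¹ * (w i * w j) by ring, Real.sq_sqrt hs.le]

theorem mem_prolong_plane {D : Distribution ι} {q w : ι ⊕ ι × ι → ℝ} :
    w ∈ D.prolong.plane q ↔ w ∈ tangentSpace D.prolong.carrier q ∧ base w ∈ line q :=
  Iff.rfl

theorem projPoint_mem_prolong {D : Distribution ι} {x v : ι → ℝ} (hx : x ∈ D.carrier)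
    (hv : v ∈ D.plane x) (h0 : v ≠ 0) : projPoint x v ∈ D.prolong.carrier :=
  mem_prolong_carrier.2 (by simpa using ⟨hx, v, hv, h0, rfl⟩)

theorem ContDiffAt.projPoint {F : Type*} [NormedAddCommGroup F] [NormedSpace ℝ F] {z : F}
    {n : WithTop ℕ∞} {x v : F → ι → ℝ} (hx : ContDiffAt ℝ n x z) (hv : ContDiffAt ℝ n v z)
    (h0 : v z ≠ 0) : ContDiffAt ℝ n (fun y => projPoint (x y) (v y)) z := by
  rw [contDiffAt_pi]
  have hv' := contDiffAt_pi.1 hv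
  rintro (i | ⟨i, j⟩)
  · exact contDiffAt_pi.1 hx i
  · exact ((hv' i).mul (hv' j)).div (ContDiffAt.sum fun l _ => (hv' l).pow 2) (sum_sq_pos h0).ne'

end ProjPoint

end Monster

/-! ### Distributions with a coordinate frame -/

namespace Monster

variable {ι κ : Type} [Fintype κ]

/-- The vector with components `s` in the frame `E` at `x`. -/
noncomputable def frameVec (E : κ → (ι → ℝ) → ι → ℝ) (x : ι → ℝ) (s : κ → ℝ) : ι → ℝ :=
  ∑ i, s i • E i x

theorem frameVec_smul (E : κ → (ι → ℝ) → ι → ℝ) (x : ι → ℝ) (a : ℝ) (s : κ → ℝ) :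
    frameVec E x (a • s) = a • frameVec E x s := by
  simp [frameVec, Finset.smul_sum, smul_smul]

variable [Fintype ι]

/-- On the part of `B` in the open set `U`, the differentials of the functions `c i` are coordinates
on the planes of `B`, with respect to a smooth frame `E`; those with `i ∉ S` vanish on the tangent
spaces, and the others can be prescribed along integral curves. -/
structure Framed (B : Distribution ι) (c : κ → (ι → ℝ) → ℝ) (E : κ → (ι → ℝ) → ι → ℝ)
    (U : Set (ι → ℝ)) (S : Set κ) : Prop where
  isOpen : IsOpen U
  smooth_coord : ∀ x ∈ U, ∀ i, ContDiffAt ℝ (⊤ : ℕ∞) (c i) x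
  smooth_frame : ∀ x ∈ U, ∀ i, ContDiffAt ℝ (⊤ : ℕ∞) (E i) x
  plane_le : ∀ x ∈ B.carrier, x ∈ U → B.plane x ≤ tangentSpace B.carrier x
  eq_frameVec : ∀ x ∈ B.carrier, x ∈ U → ∀ w ∈ B.plane x,
    w = frameVec E x fun i => fderiv ℝ (c i) x w
  eq_zero : ∀ x ∈ B.carrier, x ∈ U → ∀ w ∈ tangentSpace B.carrier x, ∀ i ∉ S,
    fderiv ℝ (c i) x w = 0
  exists_curve : ∀ x ∈ B.carrier, x ∈ U → ∀ h : ℝ → κ → ℝ, ContDiff ℝ (⊤ : ℕ∞) h →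
    (∀ i, h 0 i = c i x) → (∀ i ∉ S, ∀ t, h t i = c i x) →
    ∃ γ : ℝ → ι → ℝ, γ 0 = x ∧ ∀ᶠ t in 𝓝 (0 : ℝ), ContDiffAt ℝ (⊤ : ℕ∞) γ t ∧
      γ t ∈ B.carrier ∧ deriv γ t ∈ B.plane (γ t) ∧ ∀ i, c i (γ t) = h t i

namespace Framed

variable {B : Distribution ι} {c : κ → (ι → ℝ) → ℝ} {E : κ → (ι → ℝ) → ι → ℝ}
    {U : Set (ι → ℝ)} {S : Set κ}

theorem differentiableAt_coord (hB : Framed B c E U S) {x : ι → ℝ} (hx : x ∈ U) (i : κ) :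
    DifferentiableAt ℝ (c i) x :=
  (hB.smooth_coord x hx i).differentiableAt (by simp)

theorem ext (hB : Framed B c E U S) {x : ι → ℝ} (hx : x ∈ B.carrier) (hU : x ∈ U) {w w' : ι → ℝ}
    (hw : w ∈ B.plane x) (hw' : w' ∈ B.plane x)
    (h : ∀ i, fderiv ℝ (c i) x w = fderiv ℝ (c i) x w') : w = w' := by
  rw [hB.eq_frameVec x hx hU w hw, hB.eq_frameVec x hx hU w' hw']
  simp only [h]

/-- Integral curves with a prescribed velocity in the coordinates `c`. -/
theorem exists_curve_of_velocity (hB : Framed B c E U S) {x : ι → ℝ} (hx : x ∈ B.carrier)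
    (hU : x ∈ U) {s : κ → ℝ} (hs : ∀ i ∉ S, s i = 0) :
    ∃ γ : ℝ → ι → ℝ, γ 0 = x ∧ (∀ᶠ t in 𝓝 (0 : ℝ), ContDiffAt ℝ (⊤ : ℕ∞) γ t ∧
      γ t ∈ B.carrier ∧ deriv γ t ∈ B.plane (γ t)) ∧
      ∀ i, fderiv ℝ (c i) x (deriv γ 0) = s i := by
  obtain ⟨γ, h0, h1⟩ := hB.exists_curve x hx hU (fun t i => c i x + t * s i)
    (contDiff_pi.2 fun i => by fun_prop) (by simp) (fun i hi t => by simp [hs i hi])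
  refine ⟨γ, h0, h1.mono fun t ht => ⟨ht.1, ht.2.1, ht.2.2.1⟩, fun i => ?_⟩
  have hd := (h1.self_of_nhds.1.differentiableAt (by simp)).hasDerivAt
  have e1 := ((h0 ▸ (hB.differentiableAt_coord hU i).hasFDerivAt :
    HasFDerivAt (c i) (fderiv ℝ (c i) x) (γ 0)).comp_hasDerivAt (0 : ℝ) hd).deriv
  have e2 : (c i ∘ γ) =ᶠ[𝓝 0] fun t => c i x + t * s i := h1.mono fun t ht => ht.2.2.2 i
  rw [← e1, e2.deriv_eq]
  simp

theorem exists_mem_plane (hB : Framed B c E U S) {x : ι → ℝ} (hx : x ∈ B.carrier)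
    (hU : x ∈ U) {s : κ → ℝ} (hs : ∀ i ∉ S, s i = 0) :
    ∃ w ∈ B.plane x, ∀ i, fderiv ℝ (c i) x w = s i := by
  obtain ⟨γ, h0, h1, h2⟩ := hB.exists_curve_of_velocity hx hU hs
  exact ⟨_, h0 ▸ h1.self_of_nhds.2.2, h2⟩

theorem frameVec_mem_plane (hB : Framed B c E U S) {x : ι → ℝ} (hx : x ∈ B.carrier)
    (hU : x ∈ U) {s : κ → ℝ} (hs : ∀ i ∉ S, s i = 0) : frameVec E x s ∈ B.plane x := by
  obtain ⟨w, hw, h⟩ := hB.exists_mem_plane hx hU hs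
  have := hB.eq_frameVec x hx hU w hw
  simp only [h] at this
  exact this ▸ hw

theorem fderiv_frameVec (hB : Framed B c E U S) {x : ι → ℝ} (hx : x ∈ B.carrier)
    (hU : x ∈ U) {s : κ → ℝ} (hs : ∀ i ∉ S, s i = 0) (i : κ) :
    fderiv ℝ (c i) x (frameVec E x s) = s i := by
  obtain ⟨w, hw, h⟩ := hB.exists_mem_plane hx hU hs
  have := hB.eq_frameVec x hx hU w hw
  simp only [h] at this
  rw [← this, h]

/-- `prolongCoord` leaves the dividing coordinate in its place, whereas `KR.next` moves it to the
front; this bridges the two orders. -/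
theorem reindex {κ' : Type} [Fintype κ'] (hB : Framed B c E U S) (e : κ' ≃ κ) :
    Framed B (fun i => c (e i)) (fun i => E (e i)) U (e ⁻¹' S) where
  isOpen := hB.isOpen
  smooth_coord x hx i := hB.smooth_coord x hx (e i)
  smooth_frame x hx i := hB.smooth_frame x hx (e i)
  plane_le := hB.plane_le
  eq_frameVec x hx hU w hw := (hB.eq_frameVec x hx hU w hw).trans
    (e.sum_comp fun i => fderiv ℝ (c i) x w • E i x).symm
  eq_zero x hx hU w hw i hi := hB.eq_zero x hx hU w hw (e i) hi
  exists_curve x hx hU h hh h0 hS := by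
    obtain ⟨γ, h1, h2⟩ := hB.exists_curve x hx hU (fun t i => h t (e.symm i))
      (contDiff_pi.2 fun i => contDiff_pi.1 hh _) (fun i => by simp [h0])
      (fun i hi t => by simpa using hS (e.symm i) (by simpa using hi) t)
    exact ⟨γ, h1, h2.mono fun t ht => ⟨ht.1, ht.2.1, ht.2.2.1, fun i => by simp [ht.2.2.2]⟩⟩

end Framed

/-! ### Coordinates and frame on the prolongation -/

section Prolong

/-- The parametrization of the prolongation by a point and the components of a direction. -/
noncomputable def prolongParam (E : κ → (ι → ℝ) → ι → ℝ) (z : (ι → ℝ) × (κ → ℝ)) :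
    ι ⊕ ι × ι → ℝ :=
  projPoint z.1 (frameVec E z.1 z.2)

theorem contDiffAt_frameVec {F : Type*} [NormedAddCommGroup F] [NormedSpace ℝ F] {z : F}
    {E : κ → (ι → ℝ) → ι → ℝ} {x : F → ι → ℝ} {s : F → κ → ℝ} {n : WithTop ℕ∞}
    (hE : ∀ i, ContDiffAt ℝ n (E i) (x z)) (hx : ContDiffAt ℝ n x z) (hs : ContDiffAt ℝ n s z) :
    ContDiffAt ℝ n (fun y => frameVec E (x y) (s y)) z :=
  ContDiffAt.sum fun i _ => (contDiffAt_pi.1 hs i).smul ((hE i).comp z hx)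

theorem contDiffAt_prolongParam {E : κ → (ι → ℝ) → ι → ℝ} {z : (ι → ℝ) × (κ → ℝ)}
    {n : WithTop ℕ∞} (hE : ∀ i, ContDiffAt ℝ n (E i) z.1) (h0 : frameVec E z.1 z.2 ≠ 0) :
    ContDiffAt ℝ n (prolongParam E) z :=
  ContDiffAt.projPoint contDiffAt_fst (contDiffAt_frameVec hE contDiffAt_fst contDiffAt_snd) h0

theorem ContDiffAt.prolongParam {F : Type*} [NormedAddCommGroup F] [NormedSpace ℝ F] {z : F}
    {E : κ → (ι → ℝ) → ι → ℝ} {x : F → ι → ℝ} {s : F → κ → ℝ} {n : WithTop ℕ∞}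
    (hE : ∀ i, ContDiffAt ℝ n (E i) (x z)) (hx : ContDiffAt ℝ n x z) (hs : ContDiffAt ℝ n s z)
    (h0 : frameVec E (x z) (s z) ≠ 0) : ContDiffAt ℝ n (fun y => prolongParam E (x y, s y)) z :=
  ContDiffAt.projPoint hx (contDiffAt_frameVec hE hx hs) h0

variable [DecidableEq κ]

/-- The coordinates on the prolongation obtained by dividing by `d (c a)`. -/
noncomputable def prolongCoord (c : κ → (ι → ℝ) → ℝ) (a : κ) (i : κ) (q : ι ⊕ ι × ι → ℝ) : ℝ :=
  if i = a then c a (base q) else slope (c i) (c a) q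

/-- The homogeneous coordinates of the line of `q`, with entry `1` at `a`. -/
noncomputable def slopes (c : κ → (ι → ℝ) → ℝ) (a : κ) (q : ι ⊕ ι × ι → ℝ) (i : κ) : ℝ :=
  if i = a then 1 else slope (c i) (c a) q

/-- The frame on the prolongation that is dual to `prolongCoord`. -/
noncomputable def prolongFrame (c : κ → (ι → ℝ) → ℝ) (E : κ → (ι → ℝ) → ι → ℝ) (a : κ) (i : κ)
    (q : ι ⊕ ι × ι → ℝ) : ι ⊕ ι × ι → ℝ :=
  fderiv ℝ (prolongParam E) (base q, slopes c a q)
    (if i = a then (frameVec E (base q) (slopes c a q), 0) else (0, Pi.single i 1))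

/-- The denominator of the slopes. -/
noncomputable def slopeDenom (f : (ι → ℝ) → ℝ) (q : ι ⊕ ι × ι → ℝ) : ℝ :=
  fderiv ℝ f (base q) ((dirMatrix q).mulVec (grad f (base q)))

/-- The domain of the coordinates on the prolongation. -/
def prolongDomain (c : κ → (ι → ℝ) → ℝ) (E : κ → (ι → ℝ) → ι → ℝ) (a : κ) (U : Set (ι → ℝ)) :
    Set (ι ⊕ ι × ι → ℝ) :=
  {q | base q ∈ U ∧ slopeDenom (c a) q ≠ 0 ∧ frameVec E (base q) (slopes c a q) ≠ 0}

theorem contDiffAt_fderiv_mulVec_grad {f g : (ι → ℝ) → ℝ} {q : ι ⊕ ι × ι → ℝ}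
    (hf : ContDiffAt ℝ (⊤ : ℕ∞) f (base q)) (hg : ContDiffAt ℝ (⊤ : ℕ∞) g (base q)) :
    ContDiffAt ℝ (⊤ : ℕ∞)
      (fun q => fderiv ℝ g (base q) ((dirMatrix q).mulVec (grad f (base q)))) q := by
  have hf' : ContDiffAt ℝ (⊤ : ℕ∞) (fun q => fderiv ℝ f (base q)) q :=
    (hf.fderiv_right (by simp)).comp q contDiff_base.contDiffAt
  have hg' : ContDiffAt ℝ (⊤ : ℕ∞) (fun q => fderiv ℝ g (base q)) q :=
    (hg.fderiv_right (by simp)).comp q contDiff_base.contDiffAt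
  refine hg'.clm_apply (contDiffAt_pi.2 fun i => ?_)
  simp only [Matrix.mulVec, dotProduct, dirMatrix, Matrix.of_apply, grad]
  refine ContDiffAt.sum fun j _ => ContDiffAt.mul ?_ (hf'.clm_apply contDiffAt_const)
  exact contDiffAt_pi.1 contDiffAt_id _

namespace Framed

variable {B : Distribution ι} {c : κ → (ι → ℝ) → ℝ} {E : κ → (ι → ℝ) → ι → ℝ}
    {U : Set (ι → ℝ)} {S : Set κ} {a : κ} {q : ι ⊕ ι × ι → ℝ}

theorem contDiffAt_slopes (hB : Framed B c E U S) (hU : base q ∈ U)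
    (h0 : slopeDenom (c a) q ≠ 0) : ContDiffAt ℝ (⊤ : ℕ∞) (slopes c a) q := by
  refine contDiffAt_pi.2 fun i => ?_
  unfold slopes
  split_ifs
  · exact contDiffAt_const
  · exact (contDiffAt_fderiv_mulVec_grad (hB.smooth_coord _ hU _) (hB.smooth_coord _ hU _)).div
      (contDiffAt_fderiv_mulVec_grad (hB.smooth_coord _ hU _) (hB.smooth_coord _ hU _)) h0

/-- The three conditions are added in turn, because each function is known to be continuous only
where the earlier conditions hold. -/
theorem isOpen_prolongDomain (hB : Framed B c E U S) : IsOpen (prolongDomain c E a U) := by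
  have h1 : IsOpen ((base (ι := ι)) ⁻¹' U) :=
    hB.isOpen.preimage (contDiff_base (n := 0)).continuous
  have h2 : IsOpen ((base (ι := ι)) ⁻¹' U ∩ slopeDenom (c a) ⁻¹' {0}ᶜ) := by
    refine ContinuousOn.isOpen_inter_preimage (fun q hq => ?_) h1 isOpen_compl_singleton
    exact (contDiffAt_fderiv_mulVec_grad (hB.smooth_coord _ hq a)
      (hB.smooth_coord _ hq a)).continuousAt.continuousWithinAt
  have h3 : IsOpen (((base (ι := ι)) ⁻¹' U ∩ slopeDenom (c a) ⁻¹' {0}ᶜ) ∩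
      (fun q => frameVec E (base q) (slopes c a q)) ⁻¹' {0}ᶜ) := by
    refine ContinuousOn.isOpen_inter_preimage (fun q hq => ?_) h2 isOpen_compl_singleton
    exact (contDiffAt_frameVec (fun i => hB.smooth_frame _ hq.1 i) contDiff_base.contDiffAt
      (hB.contDiffAt_slopes hq.1 hq.2)).continuousAt.continuousWithinAt
  convert h3 using 1
  ext q
  simp [prolongDomain, and_assoc]

theorem contDiffAt_prolongCoord (hB : Framed B c E U S) (hq : q ∈ prolongDomain c E a U) (i : κ) :
    ContDiffAt ℝ (⊤ : ℕ∞) (prolongCoord c a i) q := by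
  unfold prolongCoord
  split_ifs with h
  · exact (hB.smooth_coord _ hq.1 a).comp q contDiff_base.contDiffAt
  · have := contDiffAt_pi.1 (hB.contDiffAt_slopes hq.1 hq.2.1) i
    simpa only [slopes, if_neg h] using this

theorem contDiffAt_prolongFrame (hB : Framed B c E U S) (hq : q ∈ prolongDomain c E a U) (i : κ) :
    ContDiffAt ℝ (⊤ : ℕ∞) (prolongFrame c E a i) q := by
  have hs := hB.contDiffAt_slopes hq.1 hq.2.1
  have hv := contDiffAt_frameVec (fun i => hB.smooth_frame _ hq.1 i)
    (contDiff_base (ι := ι)).contDiffAt hs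
  have hP := contDiffAt_prolongParam (z := (base q, slopes c a q))
    (fun i => hB.smooth_frame _ hq.1 i) hq.2.2
  have hz : ContDiffAt ℝ (⊤ : ℕ∞) (fun q => (base q, slopes c a q)) q :=
    contDiff_base.contDiffAt.prodMk hs
  have h1 : ContDiffAt ℝ (⊤ : ℕ∞)
      (fun q => fderiv ℝ (prolongParam E) (base q, slopes c a q)) q :=
    (hP.fderiv_right (by simp)).comp q hz
  refine h1.clm_apply ?_
  split_ifs
  · exact hv.prodMk contDiffAt_const
  · exact contDiffAt_const

/-- A line of `B`, on which `d (c a)` does not vanish, in terms of the frame. -/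
theorem eq_projPoint (hB : Framed B c E U S) (hq : q ∈ B.prolong.carrier) (hU : base q ∈ U)
    {w : ι → ℝ} (hw : w ∈ B.plane (base q)) (h0 : w ≠ 0) (hqw : q = projPoint (base q) w)
    (ha : fderiv ℝ (c a) (base q) w ≠ 0) :
    (∀ i, slopes c a q i = fderiv ℝ (c i) (base q) w / fderiv ℝ (c a) (base q) w) ∧
      w = fderiv ℝ (c a) (base q) w • frameVec E (base q) (slopes c a q) ∧
      slopeDenom (c a) q ≠ 0 := by
  have hx := (mem_prolong_carrier.1 hq).1
  have h1 : ∀ i, slopes c a q i = fderiv ℝ (c i) (base q) w / fderiv ℝ (c a) (base q) w := by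
    intro i
    unfold slopes
    split_ifs with h
    · rw [h, div_self ha]
    · conv_lhs => rw [hqw]
      exact slope_projPoint h0 ha _
  refine ⟨h1, ?_, ?_⟩
  · rw [← frameVec_smul]
    conv_lhs => rw [hB.eq_frameVec _ hx hU w hw]
    congr 1
    ext i
    simp only [Pi.smul_apply, h1, smul_eq_mul]
    field_simp
  · have := fderiv_mulVec_grad_projPoint (base q) w (c a)
    unfold slopeDenom
    conv_lhs => rw [hqw]
    rw [base_projPoint, this]
    have := (sum_sq_pos h0).ne'
    positivity

theorem mem_prolongDomain (hB : Framed B c E U S) (hq : q ∈ B.prolong.carrier) (hU : base q ∈ U)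
    {w : ι → ℝ} (hw : w ∈ B.plane (base q)) (hqw : q = projPoint (base q) w)
    (ha : fderiv ℝ (c a) (base q) w ≠ 0) : q ∈ prolongDomain c E a U := by
  have h0 : w ≠ 0 := by rintro rfl; simp at ha
  obtain ⟨-, h2, h3⟩ := hB.eq_projPoint hq hU hw h0 hqw ha
  refine ⟨hU, h3, fun h => h0 ?_⟩
  rw [h2, h, smul_zero]

/-- Together with `mem_prolongDomain`: on the prolongation, the domain consists of the lines over
`U` on which `d (c a)` does not vanish. -/
theorem exists_of_mem_prolongDomain (hq : q ∈ B.prolong.carrier)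
    (hq' : q ∈ prolongDomain c E a U) :
    ∃ w ∈ B.plane (base q), w ≠ 0 ∧ q = projPoint (base q) w ∧
      fderiv ℝ (c a) (base q) w ≠ 0 := by
  obtain ⟨-, w, hw, h0, hqw⟩ := mem_prolong_carrier.1 hq
  refine ⟨w, hw, h0, hqw, fun ha => hq'.2.1 ?_⟩
  have := fderiv_mulVec_grad_projPoint (base q) w (c a)
  unfold slopeDenom
  conv_lhs => rw [hqw]
  rw [base_projPoint, this, ha]
  simp

end Framed
end Prolong
end Monster

/-! ### Prolongations and fibers are framed -/

namespace Monster

theorem exists_primitive {g : ℝ → ℝ} (hg : ContDiff ℝ (⊤ : ℕ∞) g) (y : ℝ) :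
    ∃ G : ℝ → ℝ, ContDiff ℝ (⊤ : ℕ∞) G ∧ G 0 = y ∧ ∀ t, HasDerivAt G (g t) t := by
  have hd : ∀ t, HasDerivAt (fun u => y + ∫ x in (0 : ℝ)..u, g x) (g t) t := fun t =>
    (hg.continuous.integral_hasStrictDerivAt 0 t).hasDerivAt.const_add y
  refine ⟨_, contDiff_infty_iff_deriv.2 ⟨fun t => (hd t).differentiableAt, ?_⟩, by simp, hd⟩
  rwa [show deriv (fun u => y + ∫ x in (0 : ℝ)..u, g x) = g from funext fun t => (hd t).deriv]

variable {ι κ : Type} [Fintype ι] [Fintype κ] [DecidableEq κ]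

namespace Framed

variable {B : Distribution ι} {c : κ → (ι → ℝ) → ℝ} {E : κ → (ι → ℝ) → ι → ℝ}
    {U : Set (ι → ℝ)} {S : Set κ} {a : κ} {q : ι ⊕ ι × ι → ℝ}

/-- `prolongParam` is a smooth inverse of the base point and the slopes. Differentiating this
identity along the prolongation yields the frame. -/
theorem prolongParam_slopes (hB : Framed B c E U S) (hq : q ∈ B.prolong.carrier)
    (hq' : q ∈ prolongDomain c E a U) : prolongParam E (base q, slopes c a q) = q := by
  obtain ⟨w, hw, h0, hqw, ha⟩ := exists_of_mem_prolongDomain hq hq'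
  obtain ⟨-, h2, -⟩ := hB.eq_projPoint hq hq'.1 hw h0 hqw ha
  conv_rhs => rw [hqw, h2, projPoint_smul _ _ ha]
  rfl

theorem mem_line_iff (hB : Framed B c E U S) (hq : q ∈ B.prolong.carrier)
    (hq' : q ∈ prolongDomain c E a U) {y : ι → ℝ} :
    y ∈ line q ↔ ∃ r : ℝ, y = r • frameVec E (base q) (slopes c a q) := by
  conv_lhs => rw [← hB.prolongParam_slopes hq hq']
  exact mem_line_projPoint hq'.2.2

/-- A coordinate that is constant below has slope zero above, hence gives a constant coordinate
again: this is how a critical plane persists. -/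
theorem slopes_eq_zero (hB : Framed B c E U S) (hq : q ∈ B.prolong.carrier)
    (hq' : q ∈ prolongDomain c E a U) : ∀ i ∉ S, slopes c a q i = 0 := by
  intro i hi
  obtain ⟨w, hw, h0, hqw, ha⟩ := exists_of_mem_prolongDomain hq hq'
  obtain ⟨h1, -, -⟩ := hB.eq_projPoint hq hq'.1 hw h0 hqw ha
  rw [h1, hB.eq_zero _ hq.1 hq'.1 w (hB.plane_le _ hq.1 hq'.1 hw) i hi, zero_div]

theorem mem_of_mem_prolongDomain (hB : Framed B c E U S) (hq : q ∈ B.prolong.carrier)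
    (hq' : q ∈ prolongDomain c E a U) : a ∈ S := by
  by_contra h
  simpa [slopes] using hB.slopes_eq_zero hq hq' a h

theorem prolongCoord_eq_zero (hB : Framed B c E U S) (hq : q ∈ B.prolong.carrier)
    (hq' : q ∈ prolongDomain c E a U) {i : κ} (hi : i ∉ S) : prolongCoord c a i q = 0 := by
  have h : i ≠ a := fun h => hi (h ▸ hB.mem_of_mem_prolongDomain hq hq')
  simpa [slopes, prolongCoord, h] using hB.slopes_eq_zero hq hq' i hi

theorem fderiv_slopes (hB : Framed B c E U S) (hq : q ∈ prolongDomain c E a U)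
    (w : ι ⊕ ι × ι → ℝ) (i : κ) :
    fderiv ℝ (slopes c a) q w i = if i = a then 0 else fderiv ℝ (prolongCoord c a i) q w := by
  have hs := (hB.contDiffAt_slopes hq.1 hq.2.1).differentiableAt (by simp)
  have h1 : fderiv ℝ (slopes c a) q w i = fderiv ℝ (fun y => slopes c a y i) q w := by
    rw [show (fun y => slopes c a y i) = (fun s : κ → ℝ => s i) ∘ slopes c a from rfl,
      ((hasFDerivAt_apply (𝕜 := ℝ) i (slopes c a q)).comp q hs.hasFDerivAt).fderiv]
    rfl
  rw [h1]
  split_ifs with h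
  · simp [slopes, h]
  · congr 2
    ext y
    simp [slopes, prolongCoord, h]

theorem eventually_mem_prolongDomain (hB : Framed B c E U S) (hq : q ∈ prolongDomain c E a U) :
    ∀ᶠ y in 𝓝 q, y ∈ prolongDomain c E a U :=
  IsOpen.mem_nhds hB.isOpen_prolongDomain hq

theorem eq_fderiv_prolongParam (hB : Framed B c E U S)
    (hq' : q ∈ prolongDomain c E a U) {w : ι ⊕ ι × ι → ℝ}
    (hw : w ∈ tangentSpace B.prolong.carrier q) :
    w = fderiv ℝ (prolongParam E) (base q, slopes c a q)
      (base w, fderiv ℝ (slopes c a) q w) := by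
  have hs := (hB.contDiffAt_slopes hq'.1 hq'.2.1).differentiableAt (by simp)
  have hP := (contDiffAt_prolongParam (z := (base q, slopes c a q))
    (fun i => hB.smooth_frame _ hq'.1 i) hq'.2.2).differentiableAt (by simp)
  have hc := hP.hasFDerivAt.comp q ((hasFDerivAt_base q).prodMk hs.hasFDerivAt)
  have := fderiv_eq_on_tangentSpace differentiableAt_id hc.differentiableAt
    ((hB.eventually_mem_prolongDomain hq').mono fun y hy hyB =>
      (hB.prolongParam_slopes hyB hy).symm) hw
  rw [hc.fderiv, fderiv_fun_id] at this
  exact this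

theorem fderiv_prolongCoord_self (hB : Framed B c E U S) (hq : q ∈ prolongDomain c E a U)
    (w : ι ⊕ ι × ι → ℝ) :
    fderiv ℝ (prolongCoord c a a) q w = fderiv ℝ (c a) (base q) (base w) := by
  rw [← fderiv_comp_base (hB.differentiableAt_coord hq.1 a)]
  congr 2
  ext y
  simp [prolongCoord]

/-- A vector of the prolonged plane is determined by its image below, a multiple `r` of the vector
with components `slopes`, and by the variation of the slopes. The number `r` is its `a`-th
coordinate, since the `a`-th slope is `1`. -/
theorem prolong_eq_frameVec (hB : Framed B c E U S) (hq : q ∈ B.prolong.carrier)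
    (hq' : q ∈ prolongDomain c E a U) {w : ι ⊕ ι × ι → ℝ} (hw : w ∈ B.prolong.plane q) :
    w = frameVec (prolongFrame c E a) q fun i => fderiv ℝ (prolongCoord c a i) q w := by
  obtain ⟨hw1, hw2⟩ := mem_prolong_plane.1 hw
  obtain ⟨r, hr⟩ := (hB.mem_line_iff hq hq').1 hw2
  have ha : fderiv ℝ (prolongCoord c a a) q w = r := by
    rw [hB.fderiv_prolongCoord_self hq', hr, map_smul,
      hB.fderiv_frameVec hq.1 hq'.1 (hB.slopes_eq_zero hq hq')]
    simp [slopes]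
  conv_lhs => rw [hB.eq_fderiv_prolongParam hq' hw1]
  simp only [frameVec, prolongFrame, ← map_smul, ← map_sum]
  congr 1
  ext1
  · rw [Prod.fst_sum, Finset.sum_eq_single a]
    · rw [if_pos rfl, ha, Prod.smul_fst, hr]
      rfl
    · intro i _ hi
      simp [hi]
    · simp
  · ext i
    change fderiv ℝ (slopes c a) q w i = _
    rw [hB.fderiv_slopes hq', Prod.snd_sum, Finset.sum_apply, Finset.sum_eq_single i]
    · split_ifs with h <;> simp
    · intro j _ hj
      split_ifs <;> simp [hj.symm]
    · simp

/-- The point of the prolongation over `x` with slopes `s`. -/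
theorem prolongParam_mem (hB : Framed B c E U S) {x : ι → ℝ} (hx : x ∈ B.carrier) (hU : x ∈ U)
    {s : κ → ℝ} (hs : ∀ i ∉ S, s i = 0) (ha : s a = 1) :
    frameVec E x s ≠ 0 ∧ prolongParam E (x, s) ∈ B.prolong.carrier ∧
      prolongParam E (x, s) ∈ prolongDomain c E a U ∧ slopes c a (prolongParam E (x, s)) = s := by
  have h1 := fun i => hB.fderiv_frameVec hx hU hs i
  have h0 : frameVec E x s ≠ 0 := by
    intro h
    have := h1 a
    rw [h, ha] at this
    simp at this
  have hv := hB.frameVec_mem_plane hx hU hs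
  have hq : prolongParam E (x, s) ∈ B.prolong.carrier := projPoint_mem_prolong hx hv h0
  have hb : base (prolongParam E (x, s)) = x := base_projPoint _ _
  have ha' : fderiv ℝ (c a) x (frameVec E x s) ≠ 0 := by rw [h1, ha]; exact one_ne_zero
  refine ⟨h0, hq, hB.mem_prolongDomain hq (by rwa [hb]) (by rwa [hb]) (by rw [hb]; rfl)
    (by rwa [hb]), ?_⟩
  ext i
  rw [(hB.eq_projPoint hq (by rwa [hb]) (by rwa [hb]) h0 (by rw [hb]; rfl) (by rwa [hb])).1 i, hb,
    h1, h1, ha, div_one]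

theorem prolong_exists_curve (hB : Framed B c E U S) (hq : q ∈ B.prolong.carrier)
    (hq' : q ∈ prolongDomain c E a U) {h : ℝ → κ → ℝ} (hh : ContDiff ℝ (⊤ : ℕ∞) h)
    (h0 : ∀ i, h 0 i = prolongCoord c a i q) (hS : ∀ i ∉ S, ∀ t, h t i = prolongCoord c a i q) :
    ∃ γ : ℝ → (ι ⊕ ι × ι → ℝ), γ 0 = q ∧ ∀ᶠ t in 𝓝 (0 : ℝ), ContDiffAt ℝ (⊤ : ℕ∞) γ t ∧
      γ t ∈ B.prolong.carrier ∧ deriv γ t ∈ B.prolong.plane (γ t) ∧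
      ∀ i, prolongCoord c a i (γ t) = h t i := by
  have hhi := contDiff_pi.1 hh
  have haS := hB.mem_of_mem_prolongDomain hq hq'
  -- the slopes along the curve, and the coordinates of its projection
  set s : ℝ → κ → ℝ := fun t i => if i = a then 1 else h t i with hsdef
  have hs : ContDiff ℝ (⊤ : ℕ∞) s := contDiff_pi.2 fun i => by
    by_cases hi : i = a
    · simpa [hsdef, hi] using contDiff_const
    · simpa [hsdef, hi] using hhi i
  have hsi := contDiff_pi.1 hs
  have hsS : ∀ t, ∀ i ∉ S, s t i = 0 := fun t i hi => by
    have : i ≠ a := fun e => hi (e ▸ haS)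
    simp [hsdef, this, hS i hi, hB.prolongCoord_eq_zero hq hq' hi]
  have hsa : ∀ t, s t a = 1 := fun t => by simp [hsdef]
  have hs0 : s 0 = slopes c a q := by
    ext i
    by_cases hi : i = a <;> simp [hsdef, slopes, hi, h0, prolongCoord]
  have hda : ContDiff ℝ (⊤ : ℕ∞) (deriv fun t => h t a) := (contDiff_infty_iff_deriv.1 (hhi a)).2
  -- A lifted curve is integral when `d (c i) = s i * d (c a)`. With the slopes and `c a`
  -- prescribed, the remaining coordinates below are found by integration. The cases `i = a` and `i
  -- ∉ S` are treated apart, to get `h t a` and constants exactly.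
  have hprim : ∀ i, ∃ G : ℝ → ℝ, ContDiff ℝ (⊤ : ℕ∞) G ∧ G 0 = c i (base q) ∧
      (∀ t, HasDerivAt G (s t i * deriv (fun t => h t a) t) t) ∧ (i = a → G = fun t => h t a) ∧
      (i ∉ S → ∀ t, G t = c i (base q)) := by
    intro i
    by_cases hi : i = a
    · subst hi
      refine ⟨fun t => h t i, hhi i, by simp [h0, prolongCoord], fun t => ?_, fun _ => rfl,
        fun h => absurd haS h⟩
      rw [hsa, one_mul]
      exact (((hhi i).differentiable (by simp)) t).hasDerivAt
    by_cases hiS : i ∈ S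
    · obtain ⟨G, g1, g2, g3⟩ := exists_primitive ((hsi i).mul hda) (c i (base q))
      exact ⟨G, g1, g2, g3, fun e => absurd e hi, fun e => absurd hiS e⟩
    · refine ⟨fun _ => c i (base q), contDiff_const, rfl, fun t => ?_, fun e => absurd e hi,
        fun _ _ => rfl⟩
      rw [hsS t i hiS, zero_mul]
      exact hasDerivAt_const _ _
  choose G g1 g2 g3 g4 g5 using hprim
  obtain ⟨γ, γ0, hγ⟩ := hB.exists_curve (base q) hq.1 hq'.1 (fun t i => G i t)
    (contDiff_pi.2 g1) g2 g5
  have hU : ∀ᶠ t in 𝓝 (0 : ℝ), γ t ∈ U :=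
    hγ.self_of_nhds.1.continuousAt.eventually (hB.isOpen.mem_nhds (by rw [γ0]; exact hq'.1))
  have hmem := hγ.and hU
  refine ⟨fun t => prolongParam E (γ t, s t), ?_, ?_⟩
  · simp only [γ0, hs0]
    exact hB.prolongParam_slopes hq hq'
  -- The conditions are needed on a neighbourhood of each `t`, since velocities at `t` are computed
  -- there.
  filter_upwards [hmem.eventually_nhds] with t ht
  obtain ⟨⟨k1, k2, k3, k4⟩, k5⟩ := ht.self_of_nhds
  obtain ⟨m1, m2, m3, m4⟩ := hB.prolongParam_mem k2 k5 (hsS t) (hsa t)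
  have hsm : ContDiffAt ℝ (⊤ : ℕ∞) (fun t => prolongParam E (γ t, s t)) t :=
    ContDiffAt.prolongParam (fun i => hB.smooth_frame _ k5 i) k1 hs.contDiffAt m1
  refine ⟨hsm, m2, mem_prolong_plane.2 ⟨?_, ?_⟩, fun i => ?_⟩
  · have hmem : ∀ᶠ r in 𝓝 t, prolongParam E (γ r, s r) ∈ B.prolong.carrier :=
      ht.mono fun r hr => (hB.prolongParam_mem hr.1.2.1 hr.2 (hsS r) (hsa r)).2.1
    exact deriv_mem_tangentSpace (γ := fun t => prolongParam E (γ t, s t)) hsm hmem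
  · rw [hB.mem_line_iff m2 m3, m4]
    have hb : base (prolongParam E (γ t, s t)) = γ t := base_projPoint _ _
    rw [hb]
    have hd := (k1.differentiableAt (by simp)).hasDerivAt
    have e1 : base (deriv (fun t => prolongParam E (γ t, s t)) t) = deriv γ t := by
      have e := hasDerivAt_base (hsm.differentiableAt (by simp)).hasDerivAt
      have e' : (fun r => base (prolongParam E (γ r, s r))) = γ :=
        funext fun r => base_projPoint _ _
      rw [e'] at e
      exact e.deriv.symm
    refine ⟨deriv (fun t => h t a) t, ?_⟩
    rw [e1, hB.eq_frameVec _ k2 k5 _ k3, ← frameVec_smul]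
    congr 1
    ext i
    have e2 := ((hB.differentiableAt_coord k5 i).hasFDerivAt.comp_hasDerivAt t hd).deriv
    have e3 : (c i ∘ γ) =ᶠ[𝓝 t] G i := ht.mono fun r hr => hr.1.2.2.2 i
    rw [← e2, e3.deriv_eq, (g3 i t).deriv, Pi.smul_apply, smul_eq_mul, mul_comm]
  · by_cases hi : i = a
    · subst hi
      have hb : base (prolongParam E (γ t, s t)) = γ t := base_projPoint _ _
      simp [prolongCoord, hb, k4, g4]
    · have := congrFun m4 i
      simp only [slopes, hsdef, if_neg hi] at this
      simpa [prolongCoord, hi] using this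

/-- The prolongation of a framed distribution is framed. -/
theorem prolong (hB : Framed B c E U S) (a : κ) :
    Framed B.prolong (prolongCoord c a) (prolongFrame c E a) (prolongDomain c E a U) S where
  isOpen := hB.isOpen_prolongDomain
  smooth_coord _ hq i := hB.contDiffAt_prolongCoord hq i
  smooth_frame _ hq i := hB.contDiffAt_prolongFrame hq i
  plane_le _ _ _ := inf_le_left
  eq_frameVec _ hq hq' _ hw := hB.prolong_eq_frameVec hq hq' hw
  eq_zero q hq hq' w hw i hi := by
    have := fderiv_eq_on_tangentSpace (h := fun _ => (0 : ℝ))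
      ((hB.contDiffAt_prolongCoord hq' i).differentiableAt (by simp)) (differentiableAt_const _)
      ((hB.eventually_mem_prolongDomain hq').mono fun y hy hyB =>
        hB.prolongCoord_eq_zero hyB hy hi) hw
    simpa using this
  exists_curve _ hq hq' _ hh h0 hS := hB.prolong_exists_curve hq hq' hh h0 hS

/-- The fibers of the prolongation are framed by the coordinates other than the one that divides. -/
theorem fiber (hB : Framed B c E U Set.univ) (a : κ) (p : ι → ℝ) {F : Set (ι ⊕ ι × ι → ℝ)}
    (hF : ∀ q, q ∈ F ↔ q ∈ B.prolong.carrier ∧ base q = p) :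
    Framed ⟨F, tangentSpace F⟩ (prolongCoord c a) (prolongFrame c E a) (prolongDomain c E a U)
      {a}ᶜ := by
  have hB' := hB.prolong a
  have hle : F ⊆ B.prolong.carrier := fun q hq => ((hF q).1 hq).1
  have hbase : ∀ q ∈ F, ∀ w ∈ tangentSpace F q, base w = 0 := fun q _ w hw =>
    base_eq_zero_of_mem_tangentSpace (fun y hy => ((hF y).1 hy).2) hw
  refine ⟨hB'.isOpen, hB'.smooth_coord, hB'.smooth_frame, fun _ _ _ => le_rfl, ?_, ?_, ?_⟩
  · intro q hq hU w hw
    refine hB'.eq_frameVec q (hle hq) hU w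
      (mem_prolong_plane.2 ⟨tangentSpace_mono hle q hw, ?_⟩)
    rw [hbase q hq w hw]
    exact Submodule.zero_mem _
  · intro q hq hU w hw i hi
    obtain rfl : i = a := by simpa using hi
    rw [hB.fderiv_prolongCoord_self hU, hbase q hq w hw, map_zero]
  · intro q hq hU h hh h0 hS
    -- In the fiber the base point, and with it coordinate `a`, is fixed, so the slopes alone trace
    -- the curve and nothing is integrated.
    set s : ℝ → κ → ℝ := fun t i => if i = a then 1 else h t i with hsdef
    have hs : ContDiff ℝ (⊤ : ℕ∞) s := contDiff_pi.2 fun i => by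
      by_cases hi : i = a
      · simpa [hsdef, hi] using contDiff_const
      · simpa [hsdef, hi] using contDiff_pi.1 hh i
    have hs0 : s 0 = slopes c a q := by
      ext i
      by_cases hi : i = a <;> simp [hsdef, slopes, hi, h0, prolongCoord]
    have hx := ((hF q).1 hq).1.1
    have hb : ∀ t, base (prolongParam E (base q, s t)) = base q := fun t => base_projPoint _ _
    have hm := fun t => hB.prolongParam_mem (a := a) (s := s t) hx hU.1 (by simp)
      (by simp [hsdef])
    have hmF : ∀ t, prolongParam E (base q, s t) ∈ F := fun t =>
      (hF _).2 ⟨(hm t).2.1, (hb t).trans ((hF q).1 hq).2⟩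
    have hsm : ∀ t, ContDiffAt ℝ (⊤ : ℕ∞) (fun t => prolongParam E (base q, s t)) t := fun t =>
      ContDiffAt.prolongParam (fun i => hB.smooth_frame _ hU.1 i) contDiffAt_const
        hs.contDiffAt (hm t).1
    have hder : ∀ t, deriv (fun t => prolongParam E (base q, s t)) t ∈
        tangentSpace F (prolongParam E (base q, s t)) := fun t =>
      deriv_mem_tangentSpace (γ := fun t => prolongParam E (base q, s t)) (hsm t)
        (Filter.Eventually.of_forall hmF)
    refine ⟨fun t => prolongParam E (base q, s t), ?_, Filter.Eventually.of_forall fun t =>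
      ⟨hsm t, hmF t, hder t, fun i => ?_⟩⟩
    · simp only [hs0]
      exact hB.prolongParam_slopes (hle hq) hU
    · by_cases hi : i = a
      · subst hi
        simp [hS i (by simp), prolongCoord, hb]
      · have := congrFun (hm t).2.2.2 i
        simp only [slopes, hsdef, if_neg hi] at this
        simpa [prolongCoord, hi] using this

end Framed
end Monster

namespace Monster

/-! ### Frames of the tower and of the Baby Monsters -/

/-- The coordinates `(f, u, v)` as a family. -/
def KR.coords {ι : Type} (c : KR ι) : Fin 3 → (ι → ℝ) → ℝ := ![c.f, c.u, c.v]

open Classical in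
/-- The index of the first nonzero component. -/
noncomputable def pivot (x : Fin 3 → ℝ) : Fin 3 := if x 0 ≠ 0 then 0 else if x 1 ≠ 0 then 1 else 2

theorem apply_pivot_ne_zero {x : Fin 3 → ℝ} (hx : x ≠ 0) : x (pivot x) ≠ 0 := by
  unfold pivot
  split_ifs with h0 h1
  · exact h0
  · exact h1
  · intro h2
    push Not at h0 h1
    exact hx (funext fun i => by fin_cases i <;> assumption)

/-- The order of the coordinates after division by the coordinate `a`. -/
def pivotPerm : Fin 3 → Equiv.Perm (Fin 3) := ![1, Equiv.swap 0 1, (finRotate 3)⁻¹]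

theorem pivotPerm_symm_self (a : Fin 3) : (pivotPerm a).symm a = 0 := by
  fin_cases a <;> decide

/-- A differential is nonzero on a line iff it is nonzero on a spanning vector, so the case
distinction of `KR.next` is the choice of `pivot`. -/
theorem coords_next {ι : Type} [Fintype ι] (c : KR ι) {q : ι ⊕ ι × ι → ℝ} {w : ι → ℝ}
    (hw : w ≠ 0) (hq : q = projPoint (base q) w) {x : Fin 3 → ℝ}
    (hx : ∀ i, fderiv ℝ (c.coords i) (base q) w = x i) :
    (c.next q).coords = fun i => prolongCoord c.coords (pivot x) (pivotPerm (pivot x) i) := by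
  have key : ∀ g : (ι → ℝ) → ℝ, NonzeroOn g (base q) (line q) ↔ fderiv ℝ g (base q) w ≠ 0 := by
    intro g
    constructor
    · rintro ⟨y, hy, h⟩ h0
      rw [hq, mem_line_projPoint hw] at hy
      obtain ⟨r, rfl⟩ := hy
      simp [h0] at h
    · intro h
      refine ⟨w, ?_, h⟩
      rw [hq, mem_line_projPoint hw]
      exact ⟨1, by simp⟩
  have h0 := hx 0
  have h1 := hx 1
  simp only [KR.coords, Matrix.cons_val_zero, Matrix.cons_val_one] at h0 h1
  unfold KR.next pivot
  simp only [key, h0, h1]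
  split_ifs <;> funext i y <;> fin_cases i <;> rfl

theorem framed_top {ι : Type} [Fintype ι] [DecidableEq ι] :
    Framed ⟨Set.univ, fun _ => ⊤⟩ (fun i (x : ι → ℝ) => x i) (fun i _ => Pi.single i 1) Set.univ
      Set.univ := by
  have hd : ∀ (i : ι) (x w : ι → ℝ), fderiv ℝ (fun x : ι → ℝ => x i) x w = w i := fun i x w =>
    congrArg (fun L => L w) (hasFDerivAt_apply (𝕜 := ℝ) i x).fderiv
  refine ⟨isOpen_univ, fun _ _ i => contDiffAt_pi.1 contDiffAt_id i, fun _ _ i => contDiffAt_const,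
    ?_, ?_, fun _ _ _ _ _ i hi => absurd trivial hi, ?_⟩
  · intro x _ _ w _
    refine Submodule.subset_span ⟨fun t => x + t • w, ?_, by simp, .of_forall fun _ => trivial, ?_⟩
    · fun_prop
    · have : HasDerivAt (fun t : ℝ => x + t • w) ((1 : ℝ) • w) 0 :=
        ((hasDerivAt_id (0 : ℝ)).smul_const w).const_add x
      simpa using this.deriv
  · intro x _ _ w _
    funext j
    simp [frameVec, hd, Pi.single_apply]
  · intro x _ _ h hh h0 _
    exact ⟨h, funext h0, .of_forall fun t => ⟨hh.contDiffAt, trivial, trivial, fun i => rfl⟩⟩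

variable {k : ℕ}

theorem mem_tower_succ {q : Vec (k + 1)} : q ∈ (tower (k + 1)).carrier ↔
    down q ∈ (tower k).carrier ∧
      ∃ w ∈ (tower k).plane (down q), w ≠ 0 ∧ q = projPoint (ι := Idx k) (down q) w :=
  mem_prolong_carrier (ι := Idx k)

/-- The differentials of `(f, u, v)` at `p`. -/
noncomputable def dcoord (p : Vec k) (i : Fin 3) : Vec k →ₗ[ℝ] ℝ :=
  (fderiv ℝ ((kr k p).coords i) p : Vec k →ₗ[ℝ] ℝ)

theorem tower_framed : (k : ℕ) → (p : Vec k) → p ∈ (tower k).carrier →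
    ∃ E U, p ∈ U ∧ Framed (tower k) (kr k p).coords E U Set.univ
  | 0, p, _ => by
    rw [show (kr 0 p).coords = fun (i : Fin 3) (x : Fin 3 → ℝ) => x i by
      funext i; fin_cases i <;> rfl]
    exact ⟨_, Set.univ, trivial, framed_top (ι := Fin 3)⟩
  | k + 1, q, hq => by
    obtain ⟨h1, w, hw, h0, hqw⟩ := mem_tower_succ.1 hq
    obtain ⟨E, U, hpU, hF⟩ := tower_framed k (down q) h1
    set x : Fin 3 → ℝ := fun i => dcoord (down q) i w with hx
    have hx0 : x ≠ 0 := fun h => h0 <| hF.ext h1 hpU hw (Submodule.zero_mem _) fun i => by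
      rw [map_zero]
      exact congrFun h i
    have hc := coords_next (ι := Idx k) (kr k (down q)) h0 hqw (x := x) fun i => rfl
    have hF' := (hF.prolong (pivot x)).reindex (pivotPerm (pivot x))
    rw [show (kr (k + 1) q).coords = _ from hc]
    exact ⟨_, _, hF.mem_prolongDomain hq hpU hw hqw (apply_pivot_ne_zero hx0), hF'⟩

theorem prolong_mono {ι : Type} [Fintype ι] {D D' : Distribution ι} (h1 : D.carrier ⊆ D'.carrier)
    (h2 : ∀ x ∈ D.carrier, D.plane x ≤ D'.plane x) :
    D.prolong.carrier ⊆ D'.prolong.carrier ∧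
      ∀ x ∈ D.prolong.carrier, D.prolong.plane x ≤ D'.prolong.plane x := by
  have h : D.prolong.carrier ⊆ D'.prolong.carrier := by
    rintro q ⟨hq, w, hw, h3, h4⟩
    exact ⟨h1 hq, w, h2 _ hq hw, h3, h4⟩
  exact ⟨h, fun x _ => inf_le_inf_right _ (tangentSpace_mono h x)⟩

theorem baby_succ_of_ne {i : ℕ} (h : i ≠ k + 1) (q : Vec (k + 1)) :
    baby (k + 1) i q = (baby k i (down q)).prolong := if_neg h

theorem baby_succ_self (q : Vec (k + 1)) :
    baby (k + 1) (k + 1) q = ⟨fiber q, tangentSpace (fiber q)⟩ := if_pos rfl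

theorem baby_le_tower : (k i : ℕ) → (p : Vec k) → (baby k i p).carrier ⊆ (tower k).carrier ∧
    ∀ x ∈ (baby k i p).carrier, (baby k i p).plane x ≤ (tower k).plane x
  | 0, _, _ => ⟨fun _ h => h.elim, fun _ h => h.elim⟩
  | k + 1, i, q => by
    by_cases h : i = k + 1
    · subst h
      rw [baby_succ_self]
      refine ⟨fun x hx => hx.1, fun x hx w hw => ?_⟩
      have h0 : base (ι := Idx k) w = 0 :=
        base_eq_zero_of_mem_tangentSpace (ι := Idx k) (p := down q) (fun y hy => hy.2) hw
      refine (mem_prolong_plane (ι := Idx k)).2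
        ⟨tangentSpace_mono (ι := Idx (k + 1)) (fun y hy => hy.1) x hw, ?_⟩
      rw [h0]
      exact Submodule.zero_mem _
    · rw [baby_succ_of_ne h]
      exact prolong_mono (baby_le_tower k i (down q)).1 (baby_le_tower k i (down q)).2

theorem toBase_of_mem_baby : (k i : ℕ) → (p x : Vec k) → x ∈ (baby k i p).carrier →
    toBase k x = toBase k p
  | 0, _, _, _, h => h.elim
  | k + 1, i, q, x, hx => by
    by_cases h : i = k + 1
    · subst h
      rw [baby_succ_self] at hx
      exact congrArg (toBase k) hx.2
    · rw [baby_succ_of_ne h] at hx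
      exact toBase_of_mem_baby k i (down q) (down x) hx.1

theorem Passes.le : {k i : ℕ} → {p : Vec k} → Passes i p → 1 ≤ i ∧ i ≤ k
  | 0, _, _, h => h.elim
  | k + 1, i, q, hx => by
    by_cases h : i = k + 1
    · omega
    · unfold Passes at hx
      rw [baby_succ_of_ne h] at hx
      have := Passes.le (p := down q) hx.1
      omega

/-- The plane of `Δ_k(p)` on which the differential of the coordinate `j` vanishes. -/
noncomputable def coordPlane (p : Vec k) (j : Fin 3) : Submodule ℝ (Vec k) :=
  (tower k).plane p ⊓ LinearMap.ker (dcoord p j)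

/-- On the Baby Monster born at level `i`, the coordinate `j` is constant near `p`. -/
def BabyAt (i : ℕ) (p : Vec k) (j : Fin 3) : Prop :=
  ∃ E U, p ∈ U ∧ Framed (baby k i p) (kr k p).coords E U {j}ᶜ

theorem tower_ext {p w w' : Vec k} (hp : p ∈ (tower k).carrier) (hw : w ∈ (tower k).plane p)
    (hw' : w' ∈ (tower k).plane p) (h : ∀ i, dcoord p i w = dcoord p i w') : w = w' := by
  obtain ⟨E, U, hU, hF⟩ := tower_framed k p hp
  exact hF.ext hp hU hw hw' h

theorem exists_dcoord_eq {p : Vec k} (hp : p ∈ (tower k).carrier) (s : Fin 3 → ℝ) :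
    ∃ w ∈ (tower k).plane p, ∀ i, dcoord p i w = s i := by
  obtain ⟨E, U, hU, hF⟩ := tower_framed k p hp
  exact hF.exists_mem_plane hp hU (s := s) (by simp)

variable {i : ℕ} {j : Fin 3}

/-- The curve is prescribed by the components of `w`. Its velocity and `w` both lie in `Δ_k(p)` and
have the same components, hence coincide. -/
theorem BabyAt.exists_curve {p w : Vec k} (h : BabyAt i p j) (hi : Passes i p)
    (hw : w ∈ coordPlane p j) :
    ∃ γ : ℝ → Vec k, γ 0 = p ∧ (∀ᶠ t in 𝓝 (0 : ℝ), ContDiffAt ℝ (⊤ : ℕ∞) γ t ∧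
      γ t ∈ (baby k i p).carrier ∧ deriv γ t ∈ (baby k i p).plane (γ t)) ∧ deriv γ 0 = w := by
  obtain ⟨E, U, hU, hF⟩ := h
  obtain ⟨hle, hle'⟩ := baby_le_tower k i p
  obtain ⟨γ, h0, h1, h2⟩ := hF.exists_curve_of_velocity hi hU (s := fun i => dcoord p i w)
    (fun i hi => by
      obtain rfl : i = j := by simpa using hi
      exact hw.2)
  exact ⟨γ, h0, h1, tower_ext (hle hi)
    (hle' _ hi (by have := h1.self_of_nhds.2.2; rwa [h0] at this)) hw.1 h2⟩

theorem BabyAt.plane_eq {p : Vec k} (h : BabyAt i p j) (hi : Passes i p) :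
    (baby k i p).plane p = coordPlane p j := by
  apply le_antisymm
  · intro w hw
    refine ⟨(baby_le_tower k i p).2 _ hi hw, ?_⟩
    obtain ⟨E, U, hU, hF⟩ := h
    exact hF.eq_zero p hi hU w (hF.plane_le p hi hU hw) j (by simp)
  · intro w hw
    obtain ⟨γ, h0, h1, h2⟩ := h.exists_curve hi hw
    have := h1.self_of_nhds.2.2
    rwa [h0, h2] at this

/-- Constancy of coordinate `j` gives one inclusion, the integral curves inside the Baby Monster
give the other. -/
theorem BabyAt.delta_eq {p : Vec k} (h : BabyAt i p j) (hi : Passes i p) :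
    delta i p = coordPlane p j := by
  obtain ⟨E, U, hU, hF⟩ := id h
  apply le_antisymm
  · intro w hw
    exact ⟨hw.1, hF.eq_zero p hi hU w hw.2 j (by simp)⟩
  · intro w hw
    refine ⟨hw.1, hF.plane_le p hi hU ?_⟩
    rwa [h.plane_eq hi]

/-- A Baby Monster lies over a single point of `ℝ³`, so its integral curves witness criticality. -/
theorem BabyAt.isCriticalDir {p w : Vec k} {ℓ : Submodule ℝ (Vec k)} (h : BabyAt i p j)
    (hi : Passes i p) (hw : w ∈ coordPlane p j) (h0 : w ≠ 0) (hℓ : w ∈ ℓ) :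
    IsCriticalDir p ℓ := by
  obtain ⟨γ, g0, g1, g2⟩ := h.exists_curve hi hw
  obtain ⟨hle, hle'⟩ := baby_le_tower k i p
  refine ⟨γ, g1.self_of_nhds.1, g0, g1.mono fun t ht => ⟨hle ht.2.1, hle' _ ht.2.1 ht.2.2,
    toBase_of_mem_baby k i p _ ht.2.1⟩, by rwa [g2], by rwa [g2]⟩

theorem coordPlane_injective {p : Vec k} (hp : p ∈ (tower k).carrier) :
    Function.Injective (coordPlane p) := by
  intro i j h
  obtain ⟨w, hw, h1⟩ := exists_dcoord_eq hp (fun l => if l = i then 0 else 1)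
  have : w ∈ coordPlane p j := h ▸ ⟨hw, by simp [h1]⟩
  have h2 : dcoord p j w = 0 := this.2
  rw [h1] at h2
  by_contra hij
  simp [Ne.symm hij] at h2

end Monster

namespace Monster

/-! ### Births and survival of critical planes -/

variable {k : ℕ} {i : ℕ} {j : Fin 3}

theorem mem_coordPlane {p w : Vec k} (hw : w ∈ (tower k).plane p) :
    w ∈ coordPlane p j ↔ dcoord p j w = 0 :=
  ⟨fun h => h.2, fun h => ⟨hw, h⟩⟩

theorem dir_le_iff {q : Vec (k + 1)} {w : Vec k} (h0 : w ≠ 0)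
    (hqw : q = projPoint (ι := Idx k) (down q) w) {W : Submodule ℝ (Vec k)} :
    dir q ≤ W ↔ w ∈ W := by
  have h : ∀ y, y ∈ dir q ↔ ∃ c : ℝ, y = c • w := fun y => by
    unfold dir
    rw [hqw]
    exact mem_line_projPoint h0
  constructor
  · intro hle
    exact hle ((h w).2 ⟨1, (one_smul _ _).symm⟩)
  · intro hw y hy
    obtain ⟨c, rfl⟩ := (h y).1 hy
    exact W.smul_mem c hw

theorem dcoord_ne_zero {p w : Vec k} (hp : p ∈ (tower k).carrier) (hw : w ∈ (tower k).plane p)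
    (h0 : w ≠ 0) : (fun i => dcoord p i w) ≠ 0 := fun h =>
  h0 <| tower_ext hp hw (Submodule.zero_mem _) fun i => by
    rw [map_zero]
    exact congrFun h i

/-- A point of the tower of positive level, with a vector `w` that spans its line and the
components `x` of `w`. -/
structure LineSpan (q : Vec (k + 1)) (w : Vec k) (x : Fin 3 → ℝ) : Prop where
  mem : q ∈ (tower (k + 1)).carrier
  mem_plane : w ∈ (tower k).plane (down q)
  ne_zero : w ≠ 0
  eq : q = projPoint (ι := Idx k) (down q) w
  comp : ∀ i, dcoord (down q) i w = x i

namespace LineSpan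

variable {q : Vec (k + 1)} {w : Vec k} {x : Fin 3 → ℝ}

theorem comp_ne_zero (h : LineSpan q w x) : x ≠ 0 := by
  have := dcoord_ne_zero (mem_tower_succ.1 h.mem).1 h.mem_plane h.ne_zero
  rwa [funext h.comp] at this

theorem coords_eq (h : LineSpan q w x) : (kr (k + 1) q).coords = fun i =>
    prolongCoord (kr k (down q)).coords (pivot x) (pivotPerm (pivot x) i) :=
  coords_next (ι := Idx k) (kr k (down q)) h.ne_zero h.eq h.comp

/-- Birth: along a fiber the dividing coordinate is constant, and after the reordering it is the new
`f`. -/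
theorem babyAt_zero (h : LineSpan q w x) : BabyAt (k + 1) q 0 := by
  obtain ⟨E, U, hU, hF⟩ := tower_framed k _ (mem_tower_succ.1 h.mem).1
  have ha : fderiv ℝ ((kr k (down q)).coords (pivot x)) (down q) w ≠ 0 := by
    have := h.comp (pivot x)
    unfold dcoord at this
    exact this ▸ apply_pivot_ne_zero h.comp_ne_zero
  have hF' := (hF.fiber (pivot x) (down q) (F := fiber q) fun y => Iff.rfl).reindex
    (pivotPerm (pivot x))
  have hS : pivotPerm (pivot x) ⁻¹' {pivot x}ᶜ = {0}ᶜ := by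
    ext i
    rw [← pivotPerm_symm_self (pivot x)]
    simp [Equiv.eq_symm_apply]
  rw [hS] at hF'
  unfold BabyAt
  rw [h.coords_eq, baby_succ_self]
  exact ⟨_, _, hF.mem_prolongDomain h.mem hU h.mem_plane h.eq ha, hF'⟩

/-- Survival: prolonging the Baby Monster retains exactly the lines in its plane, and by
`BabyAt.plane_eq` that plane is the zero set of component `j`. -/
theorem passes_iff (h : LineSpan q w x) (hi : Passes i (down q)) (hb : BabyAt i (down q) j) :
    Passes i q ↔ x j = 0 := by
  have hik : i ≠ k + 1 := by have := hi.le; omega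
  have hpl := hb.plane_eq hi
  unfold Passes
  rw [baby_succ_of_ne hik, ← h.comp j, ← mem_coordPlane h.mem_plane, ← hpl]
  constructor
  · intro hq
    obtain ⟨-, w', hw', h0', hq'⟩ := (mem_prolong_carrier (ι := Idx k)).1 hq
    exact (dir_le_iff h.ne_zero h.eq).1 ((dir_le_iff h0' hq').2 hw')
  · intro hw
    exact (mem_prolong_carrier (ι := Idx k)).2 ⟨hi, w, hw, h.ne_zero, h.eq⟩

theorem babyAt (h : LineSpan q w x) (hi : Passes i (down q)) (hb : BabyAt i (down q) j)
    (hx : x j = 0) : BabyAt i q ((pivotPerm (pivot x)).symm j) := by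
  have hq := (h.passes_iff hi hb).2 hx
  have hik : i ≠ k + 1 := by have := hi.le; omega
  have hpl := hb.plane_eq hi
  obtain ⟨E, U, hU, hF⟩ := hb
  unfold Passes at hq
  rw [baby_succ_of_ne hik] at hq
  have hw : w ∈ (baby k i (down q)).plane (down q) := by
    rw [hpl, mem_coordPlane h.mem_plane, h.comp, hx]
  have ha : fderiv ℝ ((kr k (down q)).coords (pivot x)) (down q) w ≠ 0 := by
    have := h.comp (pivot x)
    unfold dcoord at this
    exact this ▸ apply_pivot_ne_zero h.comp_ne_zero
  have hF' := (hF.prolong (pivot x)).reindex (pivotPerm (pivot x))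
  have hS : pivotPerm (pivot x) ⁻¹' {j}ᶜ = {(pivotPerm (pivot x)).symm j}ᶜ := by
    ext i
    simp [Equiv.eq_symm_apply]
  rw [hS] at hF'
  unfold BabyAt
  rw [h.coords_eq, baby_succ_of_ne hik]
  exact ⟨_, _, hF.mem_prolongDomain hq hU hw h.eq ha, hF'⟩

end LineSpan

theorem exists_lineSpan {q : Vec (k + 1)} (hq : q ∈ (tower (k + 1)).carrier) :
    ∃ w x, LineSpan q w x := by
  obtain ⟨-, w, hw, h0, hqw⟩ := mem_tower_succ.1 hq
  exact ⟨w, _, hq, hw, h0, hqw, fun i => rfl⟩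

/-- The Baby Monsters through `p` are the one born at level `k`, which gives the vertical plane, and
those born at the levels in `t.1` and `t.2`, which give `T₁` and `T₂`. -/
structure BabyState (p : Vec k) (t : Option ℕ × Option ℕ) : Prop where
  passes : ∀ i, Passes i p ↔ (1 ≤ k ∧ i = k) ∨ t.1 = some i ∨ t.2 = some i
  vert : 1 ≤ k → BabyAt k p 0
  first : ∀ i, t.1 = some i → BabyAt i p 1
  second : ∀ i, t.2 = some i → BabyAt i p 2

theorem babyState_zero (p : Vec 0) : BabyState p (none, none) where
  passes i := ⟨fun h => h.elim, by simp⟩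
  vert h := absurd h (by omega)
  first i h := by simp at h
  second i h := by simp at h

namespace BabyState

variable {p : Vec k} {t : Option ℕ × Option ℕ}

/-- The three coordinate planes are distinct (`coordPlane_injective`), so a plane cannot be critical
through a Baby Monster recorded under another index. -/
theorem isCriticalPlane_iff (h : BabyState p t) (hp : p ∈ (tower k).carrier) (j : Fin 3) :
    IsCriticalPlane p (coordPlane p j) ↔
      (1 ≤ k ∧ j = 0) ∨ (t.1 ≠ none ∧ j = 1) ∨ (t.2 ≠ none ∧ j = 2) := by
  have key : ∀ i l, Passes i p → BabyAt i p l → (delta i p = coordPlane p j ↔ j = l) := by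
    intro i l hi hb
    rw [hb.delta_eq hi, (coordPlane_injective hp).eq_iff, eq_comm]
  constructor
  · rintro ⟨i, hi, hd⟩
    rcases (h.passes i).1 hi with ⟨hk, rfl⟩ | h1 | h2
    · exact Or.inl ⟨hk, (key _ _ hi (h.vert hk)).1 hd⟩
    · exact Or.inr (Or.inl ⟨by simp [h1], (key _ _ hi (h.first i h1)).1 hd⟩)
    · exact Or.inr (Or.inr ⟨by simp [h2], (key _ _ hi (h.second i h2)).1 hd⟩)
  · rintro (⟨hk, hj⟩ | ⟨h1, hj⟩ | ⟨h1, hj⟩)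
    · have hi := (h.passes k).2 (Or.inl ⟨hk, rfl⟩)
      exact ⟨k, hi, (key _ _ hi (h.vert hk)).2 hj⟩
    · obtain ⟨i, h1⟩ := Option.ne_none_iff_exists'.1 h1
      have hi := (h.passes i).2 (Or.inr (Or.inl h1))
      exact ⟨i, hi, (key _ _ hi (h.first i h1)).2 hj⟩
    · obtain ⟨i, h1⟩ := Option.ne_none_iff_exists'.1 h1
      have hi := (h.passes i).2 (Or.inr (Or.inr h1))
      exact ⟨i, hi, (key _ _ hi (h.second i h1)).2 hj⟩

theorem isCriticalPlane_T1 (h : BabyState p t) (hp : p ∈ (tower k).carrier) :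
    IsCriticalPlane p (planeT1 p) ↔ t.1 ≠ none := by
  rw [show planeT1 p = coordPlane p 1 from rfl, h.isCriticalPlane_iff hp]
  simp

theorem isCriticalPlane_T2 (h : BabyState p t) (hp : p ∈ (tower k).carrier) :
    IsCriticalPlane p (planeT2 p) ↔ t.2 ≠ none := by
  rw [show planeT2 p = coordPlane p 2 from rfl, h.isCriticalPlane_iff hp]
  simp

theorem vertical_eq (h : BabyState p t) (hk : 1 ≤ k) : vertical p = coordPlane p 0 :=
  (h.vert hk).delta_eq ((h.passes k).2 (Or.inl ⟨hk, rfl⟩))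

end BabyState

theorem not_isCriticalDir_zero (p : Vec 0) (ℓ : Submodule ℝ (Vec 0)) : ¬ IsCriticalDir p ℓ := by
  rintro ⟨γ, -, -, h1, h2, -⟩
  refine h2 ?_
  have : γ =ᶠ[𝓝 0] fun _ => p := h1.mono fun t ht => ht.2.2
  rw [this.deriv_eq, deriv_const]

/-- The sources of `T₁` and `T₂` at level `k + 1` from those at level `k` and the next letter. -/
def nextSources (k : ℕ) (t : Option ℕ × Option ℕ) : Letter → Option ℕ × Option ℕ
  | .R => (none, none)
  | .V => (some k, none)
  | .T1 => (t.1, none)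
  | .T2 => (none, t.2)
  | .L1 => (some k, t.1)
  | .L2 => t
  | .L3 => (some k, t.2)

/-! ### From letters to the state at the next level -/

section Letters

variable {q : Vec (k + 1)} {w : Vec k} {x : Fin 3 → ℝ} {t t' : Option ℕ × Option ℕ}

theorem LineSpan.inT1_iff (h : LineSpan q w x) (ht : BabyState (down q) t) :
    InT1 (down q) (dir q) ↔ t.1 ≠ none ∧ x 1 = 0 := by
  unfold InT1
  rw [ht.isCriticalPlane_T1 (mem_tower_succ.1 h.mem).1, dir_le_iff h.ne_zero h.eq,
    show planeT1 (down q) = coordPlane (down q) 1 from rfl, mem_coordPlane h.mem_plane, h.comp]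

theorem LineSpan.inT2_iff (h : LineSpan q w x) (ht : BabyState (down q) t) :
    InT2 (down q) (dir q) ↔ t.2 ≠ none ∧ x 2 = 0 := by
  unfold InT2
  rw [ht.isCriticalPlane_T2 (mem_tower_succ.1 h.mem).1, dir_le_iff h.ne_zero h.eq,
    show planeT2 (down q) = coordPlane (down q) 2 from rfl, mem_coordPlane h.mem_plane, h.comp]

theorem LineSpan.le_vertical_iff (h : LineSpan q w x) (ht : BabyState (down q) t) (hk : 1 ≤ k) :
    dir q ≤ vertical (down q) ↔ x 0 = 0 := by
  rw [ht.vertical_eq hk, dir_le_iff h.ne_zero h.eq, mem_coordPlane h.mem_plane, h.comp]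

theorem LineSpan.isCriticalDir (h : LineSpan q w x) (ht : BabyState (down q) t)
    (hx : (1 ≤ k ∧ x 0 = 0) ∨ (t.1 ≠ none ∧ x 1 = 0) ∨ (t.2 ≠ none ∧ x 2 = 0)) :
    IsCriticalDir (down q) (dir q) := by
  have hw : w ∈ dir q := (dir_le_iff h.ne_zero h.eq).1 le_rfl
  have key : ∀ i j, Passes i (down q) → BabyAt i (down q) j → x j = 0 →
      IsCriticalDir (down q) (dir q) := fun i j hi hb hj =>
    hb.isCriticalDir hi ((mem_coordPlane h.mem_plane).2 ((h.comp j).trans hj)) h.ne_zero hw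
  rcases hx with ⟨hk, hx⟩ | ⟨h1, hx⟩ | ⟨h1, hx⟩
  · exact key k 0 ((ht.passes k).2 (Or.inl ⟨hk, rfl⟩)) (ht.vert hk) hx
  · obtain ⟨i, h1⟩ := Option.ne_none_iff_exists'.1 h1
    exact key i 1 ((ht.passes i).2 (Or.inr (Or.inl h1))) (ht.first i h1) hx
  · obtain ⟨i, h1⟩ := Option.ne_none_iff_exists'.1 h1
    exact key i 2 ((ht.passes i).2 (Or.inr (Or.inr h1))) (ht.second i h1) hx

/-- `i` is the birth level of a Baby Monster through `p` that gives the plane of index `j`. -/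
def BabyState.Index (k : ℕ) (t : Option ℕ × Option ℕ) (i : ℕ) (j : Fin 3) : Prop :=
  (1 ≤ k ∧ i = k ∧ j = 0) ∨ (t.1 = some i ∧ j = 1) ∨ (t.2 = some i ∧ j = 2)

theorem BabyState.Index.spec {p : Vec k} (ht : BabyState p t) (h : Index k t i j) :
    Passes i p ∧ BabyAt i p j := by
  rcases h with ⟨hk, rfl, rfl⟩ | ⟨h1, rfl⟩ | ⟨h1, rfl⟩
  · exact ⟨(ht.passes _).2 (Or.inl ⟨hk, rfl⟩), ht.vert hk⟩
  · exact ⟨(ht.passes i).2 (Or.inr (Or.inl h1)), ht.first i h1⟩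
  · exact ⟨(ht.passes i).2 (Or.inr (Or.inr h1)), ht.second i h1⟩

/-- The new state is determined by which planes contain the line and how the coordinates are
permuted. -/
theorem LineSpan.babyState_succ (h : LineSpan q w x) (ht : BabyState (down q) t)
    (h1 : ∀ i, t'.1 = some i →
      ∃ j, BabyState.Index k t i j ∧ x j = 0 ∧ (pivotPerm (pivot x)).symm j = 1)
    (h2 : ∀ i, t'.2 = some i →
      ∃ j, BabyState.Index k t i j ∧ x j = 0 ∧ (pivotPerm (pivot x)).symm j = 2)
    (h3 : ∀ i j, BabyState.Index k t i j → x j = 0 → t'.1 = some i ∨ t'.2 = some i) :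
    BabyState q t' := by
  refine ⟨fun i => ⟨fun hi => ?_, ?_⟩, fun _ => h.babyAt_zero, fun i hi => ?_, fun i hi => ?_⟩
  · by_cases hik : i = k + 1
    · exact Or.inl ⟨by omega, hik⟩
    · right
      have hi' : Passes i (down q) := by
        unfold Passes at hi
        rw [baby_succ_of_ne hik] at hi
        exact hi.1
      obtain ⟨j, hj⟩ : ∃ j, BabyState.Index k t i j := by
        rcases (ht.passes i).1 hi' with ⟨hk, hi⟩ | hi | hi
        · exact ⟨0, Or.inl ⟨hk, hi, rfl⟩⟩
        · exact ⟨1, Or.inr (Or.inl ⟨hi, rfl⟩)⟩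
        · exact ⟨2, Or.inr (Or.inr ⟨hi, rfl⟩)⟩
      exact h3 i j hj ((h.passes_iff hi' (hj.spec ht).2).1 hi)
  · rintro (⟨-, rfl⟩ | hi | hi)
    · unfold Passes
      rw [baby_succ_self]
      exact ⟨h.mem, rfl⟩
    · obtain ⟨j, hj, hx, -⟩ := h1 i hi
      exact (h.passes_iff (hj.spec ht).1 (hj.spec ht).2).2 hx
    · obtain ⟨j, hj, hx, -⟩ := h2 i hi
      exact (h.passes_iff (hj.spec ht).1 (hj.spec ht).2).2 hx
  · obtain ⟨j, hj, hx, he⟩ := h1 i hi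
    exact he ▸ h.babyAt (hj.spec ht).1 (hj.spec ht).2 hx
  · obtain ⟨j, hj, hx, he⟩ := h2 i hi
    exact he ▸ h.babyAt (hj.spec ht).1 (hj.spec ht).2 hx

theorem IsCriticalDir.one_le {p : Vec k} {ℓ : Submodule ℝ (Vec k)} (h : IsCriticalDir p ℓ) :
    1 ≤ k := by
  rcases k with _ | k
  · exact absurd h (not_isCriticalDir_zero _ _)
  · omega

/-- A letter tells which of the planes present contain the line. If `x 0 ≠ 0`, the pivot is `0` and
surviving planes keep their names. If `x 0 = 0`, then `V` becomes `T₁`, while `T₁` becomes `T₂` for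
pivot `2` and `T₂` stays for pivot `1`. -/
theorem BabyState.succ (hq : q ∈ (tower (k + 1)).carrier) (ht : BabyState (down q) t) {X : Letter}
    (hX : HasLetter (down q) (dir q) X) : BabyState q (nextSources k t X) := by
  obtain ⟨w, x, h⟩ := exists_lineSpan hq
  have hx : ¬ (x 0 = 0 ∧ x 1 = 0 ∧ x 2 = 0) := fun ⟨a, b, c⟩ =>
    h.comp_ne_zero (funext fun i => by fin_cases i <;> assumption)
  have hcrit := h.isCriticalDir ht
  have i1 := h.inT1_iff ht
  have i2 := h.inT2_iff ht
  have iv := h.le_vertical_iff ht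
  have p0 : x 0 ≠ 0 → pivot x = 0 := fun h => by simp [pivot, h]
  have p1 : x 0 = 0 → x 1 ≠ 0 → pivot x = 1 := fun h h' => by simp [pivot, h, h']
  have p2 : x 0 = 0 → x 1 = 0 → pivot x = 2 := fun h h' => by simp [pivot, h, h']
  have s0 : ∀ j, (pivotPerm 0).symm j = j := by decide
  have s10 : (pivotPerm 1).symm 0 = 1 := by decide
  have s12 : (pivotPerm 1).symm 2 = 2 := by decide
  have s20 : (pivotPerm 2).symm 0 = 1 := by decide
  have s21 : (pivotPerm 2).symm 1 = 2 := by decide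
  -- Both pivots can occur for the letter `V`: `x 1` may vanish when `T₁` is absent.
  have hV : x 0 = 0 → (pivotPerm (pivot x)).symm 0 = 1 := fun h0 => by
    by_cases h1 : x 1 = 0
    · rw [p2 h0 h1, s20]
    · rw [p1 h0 h1, s10]
  have hk : X ≠ .R → 1 ≤ k := by
    intro hR
    cases X <;> first | exact absurd rfl hR | exact IsCriticalDir.one_le hX.1
  cases X with
  | R =>
    -- Lines in a critical plane are critical, so a regular line lies in none and every older Baby
    -- Monster dies.
    have hn : ¬ _ := mt hcrit hX
    refine h.babyState_succ ht (by simp [nextSources]) (by simp [nextSources]) ?_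
    rintro i j (⟨hk, rfl, rfl⟩ | ⟨e, rfl⟩ | ⟨e, rfl⟩) hj
    · exact (hn (Or.inl ⟨hk, hj⟩)).elim
    · exact (hn (Or.inr (Or.inl ⟨by simp [e], hj⟩))).elim
    · exact (hn (Or.inr (Or.inr ⟨by simp [e], hj⟩))).elim
  | V =>
    have hk := hk (by simp)
    obtain ⟨-, hv, n1, n2⟩ := hX
    rw [iv hk] at hv
    rw [i1] at n1
    rw [i2] at n2
    refine h.babyState_succ ht (fun i hi => ?_) (by simp [nextSources]) ?_
    · obtain rfl : k = i := by simpa [nextSources] using hi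
      exact ⟨0, Or.inl ⟨hk, rfl, rfl⟩, hv, hV hv⟩
    · rintro i j (⟨-, rfl, rfl⟩ | ⟨e, rfl⟩ | ⟨e, rfl⟩) hj
      · exact Or.inl rfl
      · exact (n1 ⟨by simp [e], hj⟩).elim
      · exact (n2 ⟨by simp [e], hj⟩).elim
  | T1 =>
    have hk := hk (by simp)
    obtain ⟨-, y1, hv, n2⟩ := hX
    rw [iv hk] at hv
    rw [i1] at y1
    rw [i2] at n2
    refine h.babyState_succ ht (fun i hi => ?_) (by simp [nextSources]) ?_
    · exact ⟨1, Or.inr (Or.inl ⟨hi, rfl⟩), y1.2, by rw [p0 hv, s0]⟩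
    · rintro i j (⟨-, rfl, rfl⟩ | ⟨e, rfl⟩ | ⟨e, rfl⟩) hj
      · exact (hv hj).elim
      · exact Or.inl e
      · exact (n2 ⟨by simp [e], hj⟩).elim
  | T2 =>
    have hk := hk (by simp)
    obtain ⟨-, y2, hv, n1⟩ := hX
    rw [iv hk] at hv
    rw [i1] at n1
    rw [i2] at y2
    refine h.babyState_succ ht (by simp [nextSources]) (fun i hi => ?_) ?_
    · exact ⟨2, Or.inr (Or.inr ⟨hi, rfl⟩), y2.2, by rw [p0 hv, s0]⟩
    · rintro i j (⟨-, rfl, rfl⟩ | ⟨e, rfl⟩ | ⟨e, rfl⟩) hj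
      · exact (hv hj).elim
      · exact (n1 ⟨by simp [e], hj⟩).elim
      · exact Or.inr e
  | L1 =>
    have hk := hk (by simp)
    obtain ⟨-, hv, y1⟩ := hX
    rw [iv hk] at hv
    rw [i1] at y1
    refine h.babyState_succ ht (fun i hi => ?_) (fun i hi => ?_) ?_
    · obtain rfl : k = i := by simpa [nextSources] using hi
      exact ⟨0, Or.inl ⟨hk, rfl, rfl⟩, hv, hV hv⟩
    · exact ⟨1, Or.inr (Or.inl ⟨hi, rfl⟩), y1.2, by rw [p2 hv y1.2, s21]⟩
    · rintro i j (⟨-, rfl, rfl⟩ | ⟨e, rfl⟩ | ⟨e, rfl⟩) hj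
      · exact Or.inl rfl
      · exact Or.inr e
      · exact (hx ⟨hv, y1.2, hj⟩).elim
  | L2 =>
    obtain ⟨-, y1, y2⟩ := hX
    rw [i1] at y1
    rw [i2] at y2
    have hv : x 0 ≠ 0 := fun h0 => hx ⟨h0, y1.2, y2.2⟩
    refine h.babyState_succ ht (fun i hi => ?_) (fun i hi => ?_) ?_
    · exact ⟨1, Or.inr (Or.inl ⟨hi, rfl⟩), y1.2, by rw [p0 hv, s0]⟩
    · exact ⟨2, Or.inr (Or.inr ⟨hi, rfl⟩), y2.2, by rw [p0 hv, s0]⟩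
    · rintro i j (⟨-, rfl, rfl⟩ | ⟨e, rfl⟩ | ⟨e, rfl⟩) hj
      · exact (hv hj).elim
      · exact Or.inl e
      · exact Or.inr e
  | L3 =>
    have hk := hk (by simp)
    obtain ⟨-, hv, y2⟩ := hX
    rw [iv hk] at hv
    rw [i2] at y2
    have h1 : x 1 ≠ 0 := fun h1 => hx ⟨hv, h1, y2.2⟩
    refine h.babyState_succ ht (fun i hi => ?_) (fun i hi => ?_) ?_
    · obtain rfl : k = i := by simpa [nextSources] using hi
      exact ⟨0, Or.inl ⟨hk, rfl, rfl⟩, hv, hV hv⟩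
    · exact ⟨2, Or.inr (Or.inr ⟨hi, rfl⟩), y2.2, by rw [p1 hv h1, s12]⟩
    · rintro i j (⟨-, rfl, rfl⟩ | ⟨e, rfl⟩ | ⟨e, rfl⟩) hj
      · exact Or.inl rfl
      · exact (h1 hj).elim
      · exact Or.inr e

end Letters
end Monster

namespace Monster

/-! ### The critical planes of a code -/

/-- The level and the sources of `T₁`, `T₂` after the letters of `ω`, starting from `s`. -/
def runCode (s : ℕ × Option ℕ × Option ℕ) (ω : List Letter) : ℕ × Option ℕ × Option ℕ :=
  ω.foldl (fun s X => (s.1 + 1, nextSources s.1 s.2 X)) s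

/-- The birth levels of the Baby Monsters that give `T₁` and `T₂` for the code `ω`. -/
def codeSources (ω : List Letter) : Option ℕ × Option ℕ := (runCode (0, none, none) ω).2

theorem runCode_append (s : ℕ × Option ℕ × Option ℕ) (ω ω' : List Letter) :
    runCode s (ω ++ ω') = runCode (runCode s ω) ω' := List.foldl_append

theorem runCode_cons (s : ℕ × Option ℕ × Option ℕ) (X : Letter) (ω : List Letter) :
    runCode s (X :: ω) = runCode (s.1 + 1, nextSources s.1 s.2 X) ω := rfl

theorem runCode_nil (s : ℕ × Option ℕ × Option ℕ) : runCode s [] = s := rfl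

theorem runCode_fst (s : ℕ × Option ℕ × Option ℕ) (ω : List Letter) :
    (runCode s ω).1 = s.1 + ω.length := by
  induction ω generalizing s with
  | nil => rfl
  | cons X ω ih => rw [runCode_cons, ih, List.length_cons]; omega

theorem codeSources_append_singleton (ω : List Letter) (X : Letter) :
    codeSources (ω ++ [X]) = nextSources ω.length (codeSources ω) X := by
  unfold codeSources
  rw [runCode_append, runCode_cons, runCode_nil, runCode_fst, Nat.zero_add]

theorem HasCode.babyState : {k : ℕ} → {p : Vec k} → {ω : List Letter} →
    p ∈ (tower k).carrier → HasCode k p ω → BabyState p (codeSources ω) ∧ ω.length = k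
  | 0, p, ω, _, h => by
    obtain rfl : ω = [] := h
    exact ⟨babyState_zero p, rfl⟩
  | k + 1, q, ω, hq, ⟨ω₀, X, hω, h, hX⟩ => by
    obtain ⟨h1, h2⟩ := h.babyState (mem_tower_succ.1 hq).1
    rw [hω, codeSources_append_singleton, h2]
    exact ⟨h1.succ hq hX, by simp [h2]⟩

/-- The entry `(j, i)` of a Baby Monster born at level `i` and prolonged `j = k - i` times. -/
def sourceEntry (k : ℕ) (o : Option ℕ) : Option (ℕ × ℕ) := o.map fun i => (k - i, i)

theorem BabyState.sources {k : ℕ} {p : Vec k} {t : Option ℕ × Option ℕ} (h : BabyState p t)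
    (hp : p ∈ (tower k).carrier) (hk : 1 ≤ k) :
    Sources p (sourceEntry k t.1) (sourceEntry k t.2) := by
  obtain ⟨t1, t2⟩ := t
  refine ⟨?_, ?_, fun i => ?_⟩
  · rcases t1 with _ | i
    · exact fun hc => (h.isCriticalPlane_T1 hp).1 hc rfl
    · have hi := (h.passes i).2 (Or.inr (Or.inl rfl))
      exact ⟨by have := hi.le; omega, hi, (h.first i rfl).delta_eq hi⟩
  · rcases t2 with _ | i
    · exact fun hc => (h.isCriticalPlane_T2 hp).1 hc rfl
    · have hi := (h.passes i).2 (Or.inr (Or.inr rfl))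
      exact ⟨by have := hi.le; omega, hi, (h.second i rfl).delta_eq hi⟩
  · rw [h.passes]
    simp [sourceEntry, hk]

/-- The differentials of the coordinates outside `T` map `W` isomorphically onto the functions on
the complement of `T`. -/
theorem finrank_eq_of_mem_iff {k : ℕ} {p : Vec k} (hp : p ∈ (tower k).carrier)
    (W : Submodule ℝ (Vec k)) (T : Finset (Fin 3))
    (hW : ∀ w, w ∈ W ↔ w ∈ (tower k).plane p ∧ ∀ j ∈ T, dcoord p j w = 0) :
    Module.finrank ℝ W = 3 - T.card := by
  let L : W →ₗ[ℝ] ({i // i ∉ T} → ℝ) := LinearMap.pi fun i => (dcoord p i).comp W.subtype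
  have hL : Function.Bijective L := by
    constructor
    · rintro ⟨w, hw⟩ ⟨w', hw'⟩ h
      obtain ⟨a1, a2⟩ := (hW w).1 hw
      obtain ⟨b1, b2⟩ := (hW w').1 hw'
      refine Subtype.ext (tower_ext hp a1 b1 fun i => ?_)
      by_cases hi : i ∈ T
      · rw [a2 i hi, b2 i hi]
      · exact congrFun h ⟨i, hi⟩
    · intro s
      obtain ⟨w, hw, h⟩ := exists_dcoord_eq hp fun i => if hi : i ∉ T then s ⟨i, hi⟩ else 0
      refine ⟨⟨w, (hW w).2 ⟨hw, fun j hj => by simp [h, hj]⟩⟩, funext fun i => ?_⟩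
      exact (h i).trans (dif_pos i.2)
  rw [(LinearEquiv.ofBijective L hL).finrank_eq, Module.finrank_fintype_fun_eq_card]
  simp [Fintype.card_subtype_compl]

/-! ### General position of the coordinate planes -/

section Planes

variable {k : ℕ} {p : Vec k}

theorem finrank_coordPlane (hp : p ∈ (tower k).carrier) (j : Fin 3) :
    Module.finrank ℝ (coordPlane p j) = 2 :=
  finrank_eq_of_mem_iff hp _ {j} fun w => by simp [coordPlane]

theorem finrank_coordPlane_inf (hp : p ∈ (tower k).carrier) {i j : Fin 3} (hij : i ≠ j) :
    Module.finrank ℝ (coordPlane p i ⊓ coordPlane p j : Submodule ℝ (Vec k)) = 1 := by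
  rw [finrank_eq_of_mem_iff hp _ {i, j} fun w => by simp [coordPlane]; tauto,
    Finset.card_pair hij]

/-- This is linear algebra of the coordinate planes, valid whether or not `T₁` and `T₂` are
critical; their presence is recorded by `Sources`. -/
theorem BabyState.threePlanes {t : Option ℕ × Option ℕ} (h : BabyState p t)
    (hp : p ∈ (tower k).carrier) (hk : 1 ≤ k) : ThreePlanes p := by
  have h1 : planeT1 p = coordPlane p 1 := rfl
  have h2 : planeT2 p = coordPlane p 2 := rfl
  unfold ThreePlanes
  rw [h.vertical_eq hk, h1, h2]
  refine ⟨finrank_coordPlane hp 0, finrank_coordPlane hp 1, finrank_coordPlane hp 2,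
    finrank_coordPlane_inf hp (by decide), finrank_coordPlane_inf hp (by decide),
    finrank_coordPlane_inf hp (by decide), (Submodule.eq_bot_iff _).2 ?_⟩
  rintro w ⟨⟨a0, a1⟩, a2⟩
  refine tower_ext hp a0.1 (Submodule.zero_mem _) fun i => ?_
  rw [map_zero]
  fin_cases i
  exacts [a0.2, a1.2, a2.2]

theorem BabyState.twoPlanes {t : Option ℕ × Option ℕ} (h : BabyState p t)
    (hp : p ∈ (tower k).carrier) (hk : 1 ≤ k) : TwoPlanes p := by
  obtain ⟨h1, -, h2, -, -, h3, -⟩ := h.threePlanes hp hk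
  exact ⟨h1, h2, h3⟩

end Planes

/-- For the letters `L₂`, `L₃` and `T₂`, the plane `T₂` is present one level below, and so is `T₁`
for the letter `L₂`. -/
theorem HasCode.codeSources_ne_none {k : ℕ} {p : Vec k} {ω₀ : List Letter} {X : Letter}
    (hp : p ∈ (tower k).carrier) (h : HasCode k p (ω₀ ++ [X])) :
    (X = .L2 → (codeSources ω₀).1 ≠ none) ∧
      (X = .L2 ∨ X = .L3 ∨ X = .T2 → (codeSources ω₀).2 ≠ none) := by
  rcases k with _ | k
  · exact absurd h (by simp [HasCode])
  · obtain ⟨ω₁, Y, hω, h1, hY⟩ := h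
    obtain ⟨rfl, hXY⟩ := List.append_inj' hω rfl
    obtain rfl : X = Y := by simpa using hXY
    have hp' := (mem_tower_succ.1 hp).1
    have hs := (h1.babyState hp').1
    constructor
    · rintro rfl
      exact (hs.isCriticalPlane_T1 hp').1 hY.2.1.1
    · rintro (rfl | rfl | rfl)
      · exact (hs.isCriticalPlane_T2 hp').1 hY.2.2.1
      · exact (hs.isCriticalPlane_T2 hp').1 hY.2.2.1
      · exact (hs.isCriticalPlane_T2 hp').1 hY.2.1.1

/-- Before the first letter `L₂`, if `T₁` and `T₂` are both present then `T₁` was vertical one level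
below. -/
theorem codeSources_fst_of_notMem {ω : List Letter} (h : Letter.L2 ∉ ω)
    (h1 : (codeSources ω).1 ≠ none) (h2 : (codeSources ω).2 ≠ none) :
    1 ≤ ω.length ∧ (codeSources ω).1 = some (ω.length - 1) := by
  rcases List.eq_nil_or_concat ω with rfl | ⟨ω', X, rfl⟩
  · exact absurd rfl h1
  · rw [List.concat_eq_append] at *
    rw [codeSources_append_singleton] at *
    cases X <;> simp_all [nextSources]

/-! ### Running the rule on the blocks of the table -/

theorem runCode_replicate_T1 (k m : ℕ) (o : Option ℕ) :
    runCode (k, o, none) (List.replicate m .T1) = (k + m, o, none) := by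
  induction m generalizing k with
  | zero => rfl
  | succ m ih =>
    rw [List.replicate_succ, runCode_cons]
    exact (ih (k + 1)).trans (by rw [Nat.add_right_comm, Nat.add_assoc])

/-- Each `L1` shifts `T₁` to `T₂` and makes the vertical plane the new `T₁`, so two of them erase
the initial `t`. -/
theorem runCode_replicate_L1 (k s : ℕ) (t : Option ℕ × Option ℕ) :
    runCode (k, t) (List.replicate (s + 2) .L1) = (k + s + 2, some (k + s + 1), some (k + s)) := by
  induction s with
  | zero => rfl
  | succ s ih =>
    rw [List.replicate_succ', runCode_append, ih]
    rfl

/-- Only the length of the prefix matters: in every row a later `V` or a pair of `L1` overwrites its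
sources `t`. -/
theorem exists_runCode_R (w : List Letter) :
    ∃ t, runCode (0, none, none) ([.R] ++ w) = (w.length + 1, t) :=
  ⟨_, Prod.ext ((runCode_fst _ _).trans (by simp)) rfl⟩

theorem runCode_R_V (w : List Letter) (m : ℕ) :
    runCode (0, none, none) ([.R] ++ w ++ [.V] ++ List.replicate m .T1) =
      (w.length + m + 2, some (w.length + 1), none) := by
  obtain ⟨t, ht⟩ := exists_runCode_R w
  rw [runCode_append, runCode_append, ht]
  exact (runCode_replicate_T1 _ _ _).trans (by congr 1; omega)

theorem runCode_R_V_L1 (w : List Letter) (m : ℕ) {s : ℕ} (hs : 2 ≤ s) :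
    runCode (0, none, none)
      ([.R] ++ w ++ [.V] ++ List.replicate m .T1 ++ List.replicate s .L1) =
      (w.length + m + s + 2, some (w.length + m + s + 1), some (w.length + m + s)) := by
  obtain ⟨s, rfl⟩ : ∃ r, s = r + 2 := ⟨s - 2, by omega⟩
  rw [runCode_append, runCode_R_V, runCode_replicate_L1]
  congr 1
  · omega
  · congr 2 <;> omega

theorem TableRow.eq_sourceEntry {ω : List Letter} {e₁ e₂ : Option (ℕ × ℕ)}
    (h : TableRow ω e₁ e₂) : e₁ = sourceEntry ω.length (codeSources ω).1 ∧
      e₂ = sourceEntry ω.length (codeSources ω).2 := by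
  unfold codeSources
  cases h with
  | LLL2 w k hk | LLL3 w k hk | LLT2L3 w k hk | LLT2 w k hk =>
    obtain ⟨t, ht⟩ := exists_runCode_R w
    rw [runCode_append, ht]
    simp [runCode_cons, runCode_nil, nextSources, sourceEntry]
    try omega
  | VTLL2 w m | VTLT2 w m | VTLL2T2 w m | VTLL3T2 w m | VTLL3 w m | VTLT2L3 w m | VTLL2T2L3 w m =>
    rw [runCode_append, runCode_R_V]
    simp [runCode_cons, runCode_nil, nextSources, sourceEntry]
    try omega
  | VTLsL2T2L3 w m s k hs | VTLsL2T2 w m s hs | VTLsL3T2 w m s hs =>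
    rw [runCode_append, runCode_R_V_L1 w m hs]
    simp [runCode_cons, runCode_nil, nextSources, sourceEntry]
    try omega

end Monster

theorem theorem2p2 :
    (∀ (ω : List Monster.Letter) (X : Monster.Letter), Monster.FirstOccurrence ω X →
      ∃ e₁ e₂ : Option (ℕ × ℕ),
        (X = .L2 → e₁ = some (2, ω.length - 2)) ∧
        (X = .L3 → e₁ = some (1, ω.length - 1)) ∧
        (X = .T2 → e₁ = none) ∧
        e₂ ≠ none ∧
        ∀ p ∈ (Monster.tower ω.length).carrier, Monster.HasCode ω.length p ω →
          Monster.Sources p e₁ e₂ ∧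
          (X = .L2 ∨ X = .L3 → Monster.ThreePlanes p) ∧
          (X = .T2 → Monster.TwoPlanes p)) ∧
    (∀ (ω : List Monster.Letter) (X : Monster.Letter) (e₁ e₂ : Option (ℕ × ℕ)),
      Monster.TableRow ω e₁ e₂ → Monster.FirstOccurrence ω X →
        ∀ p ∈ (Monster.tower ω.length).carrier, Monster.HasCode ω.length p ω →
          Monster.Sources p e₁ e₂) := by
  refine ⟨?_, ?_⟩
  · rintro ω X ⟨hX, ω₀, rfl, hω₀⟩
    have hlen : (ω₀ ++ [X]).length = ω₀.length + 1 := by simp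
    -- For a code that no point has, the rule may give entries of the wrong form. Arbitrary entries
    -- of the right form are then used, and the claim about points is vacuous.
    by_cases hex : ∃ p ∈ (Monster.tower (ω₀ ++ [X]).length).carrier,
        Monster.HasCode (ω₀ ++ [X]).length p (ω₀ ++ [X])
    · obtain ⟨p, hp, hcode⟩ := hex
      obtain ⟨n1, n2⟩ := hcode.codeSources_ne_none hp
      refine ⟨Monster.sourceEntry (ω₀ ++ [X]).length (Monster.codeSources (ω₀ ++ [X])).1,
        Monster.sourceEntry (ω₀ ++ [X]).length (Monster.codeSources (ω₀ ++ [X])).2,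
        ?_, ?_, ?_, ?_, ?_⟩
      · rintro rfl
        -- First occurrence enters here: `T₁` was born at level `ω₀.length - 1`, and `L2` keeps it,
        -- so it has been prolonged twice. The bound `l1` keeps the subtraction exact.
        obtain ⟨l1, l2⟩ := Monster.codeSources_fst_of_notMem hω₀ (n1 rfl) (n2 hX)
        rw [Monster.codeSources_append_singleton, hlen]
        simp only [Monster.nextSources, l2, Monster.sourceEntry, Option.map_some, Option.some.injEq,
          Prod.mk.injEq]
        omega
      · rintro rfl
        rw [Monster.codeSources_append_singleton, hlen]
        simp [Monster.nextSources, Monster.sourceEntry]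
      · rintro rfl
        rw [Monster.codeSources_append_singleton]
        rfl
      · have := n2 hX
        rw [Monster.codeSources_append_singleton]
        rcases hX with rfl | rfl | rfl <;> simpa [Monster.nextSources, Monster.sourceEntry]
      · intro p hp hcode
        have hs := (hcode.babyState hp).1
        have hk : 1 ≤ (ω₀ ++ [X]).length := by omega
        exact ⟨hs.sources hp hk, fun _ => hs.threePlanes hp hk, fun _ => hs.twoPlanes hp hk⟩
    · classical
      refine ⟨if X = .L2 then some (2, (ω₀ ++ [X]).length - 2) else
        if X = .L3 then some (1, (ω₀ ++ [X]).length - 1) else none, some (0, 0), ?_, ?_, ?_, by simp,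
        fun p hp hcode => absurd ⟨p, hp, hcode⟩ hex⟩
      all_goals rintro rfl; simp
  · rintro ω X e₁ e₂ hrow ⟨-, ω₀, rfl, -⟩ p hp hcode
    obtain ⟨rfl, rfl⟩ := hrow.eq_sourceEntry
    exact (hcode.babyState hp).1.sources hp (by simp)
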